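/- Let $\mathbb K$ be a field. All graded objects below are $\mathbb N$-graded except operads, which may be $\mathbb Z$-graded, and Koszul signs are used throughout. A graded operad $\mathcal P$ is a graded symmetric operad over $\mathbb K$ (right actions of the symmetric groups, partial compositions $\circ_i$, a unit). A $\mathcal P$-algebra is a graded vector space $\mathfrak A=\bigoplus_{p\ge 0}\mathfrak A_p$ with a morphism of graded operads $\gamma:\mathcal P\to \mathrm{End}_{\mathfrak A}$; morphisms of $\mathcal P$-algebras are linear maps of degree $0$ commuting with all operations. A graded commutative algebra is a unital associative algebra $C=\bigoplus_{q\ge 0}C_q$ with $cc'=(-1)^{|c||c'|}c'c$; morphisms are unital algebra maps of degree $0$. For a $\mathcal P$-algebra $\mathfrak A$ and a graded commutative algebra $C$, the graded vector space $\mathfrak A\otimes C$ (total grading) is a $\mathcal P$-algebra through $$\bar\gamma_k(\mu)(a_1\otimes c_1,\dots,a_k\otimes c_k)=(-1)^{\sum_{i<j}|c_i||a_j|}\,\gamma_k(\mu)(a_1,\dots,a_k)\otimes c_1\cdots c_k$$ for homogeneous $a_j$, $c_j$, and this defines a functor $\mathfrak A\otimes -$ from graded commutative algebras to $\mathcal P$-algebras.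 **Theorem.** Let $\mathcal P$ be a graded operad and $\mathfrak A=\bigoplus_{p\ge 0}\mathfrak A_p$ a $\mathcal P$-algebra. (1) The functor $\mathfrak A\otimes -$ from graded commutative algebras to $\mathcal P$-algebras admits a left adjoint if and only if $\mathfrak A_p$ is finite-dimensional for every $p\ge 0$. (2) Suppose that every $\mathfrak A_p$ is finite-dimensional, with basis $a_{p1},\dots,a_{pd_p}$. For $\mu\in\mathcal P(k)$ homogeneous of degree $|\mu|$, define structure constants by $\gamma_k(\mu)(a_{p_1i_1},\dots,a_{p_ki_k})=\sum_{s=1}^{d_\theta}\alpha^{\theta,s}_{\mu,p_1i_1,\dots,p_ki_k}\,a_{\theta s}$, where $\theta=p_1+\cdots+p_k+|\mu|$ (the value is $0$ if $\theta<0$). Let $\mathcal C(\mathfrak A)$ be the quotient of the free graded commutative algebra on generators $X_{\varepsilon s,pi}$ of degree $p-\varepsilon$ (one for all $0\le\varepsilon\le p$, $1\le s\le d_\varepsilon$, $1\le i\le d_p$; this generator is abbreviated $X^{(\pi)}_{si}$ with $\pi=p-\varepsilon$ when the degrees $\varepsilon,p$ of the two basis vectors are understood) by the ideal generated by the universal graded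 polynomials $$\sum_{u=1}^{d_\theta}\alpha^{\theta,u}_{\mu,p_1i_1,\dots,p_ki_k}X_{\lambda a,\theta u}\;-\sum_{\substack{\varepsilon_1+\cdots+\varepsilon_k+|\mu|=\lambda\\ 0\le\varepsilon_r\le p_r}}\ \sum_{s_1=1}^{d_{\varepsilon_1}}\cdots\sum_{s_k=1}^{d_{\varepsilon_k}}(-1)^{\varrho}\,\alpha^{\lambda,a}_{\mu,\varepsilon_1s_1,\dots,\varepsilon_ks_k}\,X_{\varepsilon_1s_1,p_1i_1}\cdots X_{\varepsilon_ks_k,p_ki_k},$$ $$\varrho=\sum_{j=1}^{k-1}(\varepsilon_{j+1}+\cdots+\varepsilon_k)(p_j-\varepsilon_j),$$ for all $k\ge 0$, homogeneous $\mu\in\mathcal P(k)$, $p_r\ge 0$, $1\le i_r\le d_{p_r}$ with $\theta\ge 0$, and $0\le\lambda\le\theta$, $1\le a\le d_\lambda$ (this polynomial has degree $\omega=\theta-\lambda$). Let $x_{\varepsilon s,pi}$ be the class of $X_{\varepsilon s,pi}$. Then the linear map $$\eta_{\mathfrak A}:\mathfrak A\to\mathfrak A\otimes\mathcal C(\mathfrak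 A),\qquad \eta_{\mathfrak A}(a_{pi})=\sum_{\varepsilon=0}^{p}\sum_{s=1}^{d_\varepsilon}a_{\varepsilon s}\otimes x_{\varepsilon s,pi},$$ is a morphism of $\mathcal P$-algebras, and for every graded commutative algebra $C$ and every morphism of $\mathcal P$-algebras $f:\mathfrak A\to\mathfrak A\otimes C$ there is a unique morphism of graded commutative algebras $\Phi:\mathcal C(\mathfrak A)\to C$ with $f=(\mathrm{id}\otimes\Phi)\circ\eta_{\mathfrak A}$. -/

import Mathlib

open CategoryTheory TensorProduct

universe u w

namespace GradedOperads

/-! ### Graded operads -/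

/-- Positions of the inputs of a partial composite `μ ∘ᵢ ν` (`μ` of arity `m`, `ν` of arity `n`, all
positions counted from `0`): the inputs of `μ` other than the `i`-th one, and the inputs of `ν`,
which are inserted as a block in the place of the `i`-th input of `μ`. -/
def splice {m n l : ℕ} (i : Fin m) (h : l + 1 = m + n) : {j : Fin m // j ≠ i} ⊕ Fin n ≃ Fin l where
  toFun := Sum.elim
    (fun j => if hj : (j.1 : ℕ) < i then ⟨j.1, by have := i.2; omega⟩
      else ⟨j.1 + n - 1, by
        have h1 : (j.1 : ℕ) ≠ i := fun e => j.2 (Fin.ext e)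
        have := j.1.2; have := i.2; omega⟩)
    (fun t => ⟨i + t, by have := t.2; have := i.2; omega⟩)
  invFun s :=
    if h1 : (s : ℕ) < i then Sum.inl ⟨⟨s, by have := i.2; omega⟩, fun e => by
      have := congrArg Fin.val e; simp at this; omega⟩
    else if h2 : (s : ℕ) < i + n then Sum.inr ⟨s - i, by omega⟩
    else Sum.inl ⟨⟨s + 1 - n, by have := s.2; omega⟩, fun e => by
      have := congrArg Fin.val e; simp at this; omega⟩
  left_inv := by
    rintro (⟨j, hj⟩ | t)
    · have h1 : (j : ℕ) ≠ i := fun e => hj (Fin.ext e)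
      by_cases h2 : (j : ℕ) < i
      · simp [-Fin.val_fin_lt, h2]
      · have h4 : ¬ ((j : ℕ) + n - 1 < i) := by omega
        have h5 : ¬ ((j : ℕ) + n - 1 < i + n) := by omega
        have h6 : (j : ℕ) + n - 1 + 1 - n = j := by omega
        simp [-Fin.val_fin_lt, h2, h4, h5, h6]
    · simp
  right_inv := by
    intro s
    by_cases h1 : (s : ℕ) < i
    · simp [-Fin.val_fin_lt, h1]
    · by_cases h2 : (s : ℕ) < i + n
      · apply Fin.ext
        simp [-Fin.val_fin_lt, h1, h2]
        omega
      · have h3 : ¬ ((s : ℕ) + 1 - n < i) := by omega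
        apply Fin.ext
        simp [-Fin.val_fin_lt, h1, h2, h3]
        omega

/-- The block permutation `σ ∘ᵢ τ`: `σ` permutes the inputs, its `i`-th entry being replaced by a
block on which `τ` acts. -/
def blockPerm {m n l : ℕ} (i : Fin m) (h : l + 1 = m + n) (σ : Equiv.Perm (Fin m))
    (τ : Equiv.Perm (Fin n)) : Equiv.Perm (Fin l) :=
  ((splice i h).symm.trans
    (Equiv.sumCongr (σ.subtypeEquiv fun j => (σ.injective.ne_iff (x := j) (y := i)).symm) τ)).trans
    (splice (σ i) h)

/-- A graded symmetric operad over `K`, through partial compositions: a family of `ℤ`-graded vector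
spaces `obj n` with degree-preserving linear right actions of the symmetric groups, a unit of arity
`1` and degree `0`, and partial compositions `comp i μ ν = μ ∘ᵢ ν` of degree `0`. The arity `l` of
the composite is a variable with `l + 1 = m + n`, and inputs are counted from `0`. -/
structure GradedOperad (K : Type u) [Field K] where
  obj : ℕ → Type w
  [addCommGroup : ∀ n, AddCommGroup (obj n)]
  [module : ∀ n, Module K (obj n)]
  /-- the homogeneous components of `obj n` -/
  gr : ∀ n, ℤ → Submodule K (obj n)
  isInternal : ∀ n, DirectSum.IsInternal (gr n)
  /-- the right action `μ ↦ μ · σ` -/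
  perm : ∀ {n : ℕ}, Equiv.Perm (Fin n) → obj n →ₗ[K] obj n
  perm_mem : ∀ {n : ℕ} (σ : Equiv.Perm (Fin n)) (d : ℤ) (μ : obj n), μ ∈ gr n d → perm σ μ ∈ gr n d
  perm_one : ∀ {n : ℕ} (μ : obj n), perm 1 μ = μ
  perm_mul : ∀ {n : ℕ} (σ τ : Equiv.Perm (Fin n)) (μ : obj n), perm (σ * τ) μ = perm τ (perm σ μ)
  /-- the unit -/
  one : obj 1
  one_mem : one ∈ gr 1 0
  /-- the partial composition `μ ∘ᵢ ν` -/
  comp : ∀ {m n l : ℕ} (_ : Fin m) (_ : l + 1 = m + n), obj m →ₗ[K] obj n →ₗ[K] obj l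
  comp_mem : ∀ {m n l : ℕ} (i : Fin m) (h : l + 1 = m + n) (d e : ℤ) (μ : obj m) (ν : obj n),
    μ ∈ gr m d → ν ∈ gr n e → comp i h μ ν ∈ gr l (d + e)
  one_comp : ∀ {n : ℕ} (h : n + 1 = 1 + n) (μ : obj n), comp 0 h one μ = μ
  comp_one : ∀ {n : ℕ} (i : Fin n) (h : n + 1 = n + 1) (μ : obj n), comp i h μ one = μ
  /-- sequential associativity `(μ ∘ᵢ ν) ∘ᵢ₊ⱼ ξ = μ ∘ᵢ (ν ∘ⱼ ξ)` -/
  comp_seq : ∀ {m n r k k' l : ℕ} (i : Fin m) (j : Fin n) (s : Fin k) (_ : (s : ℕ) = i + j)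
    (h₁ : k + 1 = m + n) (h₂ : l + 1 = k + r) (h₃ : k' + 1 = n + r) (h₄ : l + 1 = m + k')
    (μ : obj m) (ν : obj n) (ξ : obj r),
    comp s h₂ (comp i h₁ μ ν) ξ = comp i h₄ μ (comp j h₃ ν ξ)
  /-- parallel associativity `(μ ∘ᵢ ν) ∘ⱼ₊ₙ₋₁ ξ = (-1)^(|ν||ξ|) (μ ∘ⱼ ξ) ∘ᵢ ν` for `i < j` -/
  comp_par : ∀ {m n r k k' l : ℕ} (i j : Fin m) (_ : i < j) (s : Fin k) (_ : (s : ℕ) + 1 = j + n)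
    (t : Fin k') (_ : (t : ℕ) = i)
    (h₁ : k + 1 = m + n) (h₂ : l + 1 = k + r) (h₃ : k' + 1 = m + r) (h₄ : l + 1 = k' + n)
    (d e : ℤ) (μ : obj m) (ν : obj n) (ξ : obj r), ν ∈ gr n d → ξ ∈ gr r e →
    comp s h₂ (comp i h₁ μ ν) ξ = (-1 : K) ^ (d * e) • comp t h₄ (comp j h₃ μ ξ) ν
  /-- equivariance -/
  comp_perm : ∀ {m n l : ℕ} (i : Fin m) (h : l + 1 = m + n) (σ : Equiv.Perm (Fin m))
    (τ : Equiv.Perm (Fin n)) (μ : obj m) (ν : obj n),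
    comp i h (perm σ μ) (perm τ ν) = perm (blockPerm i h σ τ) (comp (σ i) h μ ν)

attribute [instance] GradedOperad.addCommGroup GradedOperad.module

/-! ### Algebras over a graded operad -/

section Signs

variable {K : Type u} [Field K]

/-- The exponent of the Koszul sign of the permutation `σ` acting on factors of degrees `p`: the sum
of `p i * p j` over the inversions of `σ`. -/
def permSign {n : ℕ} (σ : Equiv.Perm (Fin n)) (p : Fin n → ℕ) : ℤ :=
  ∑ i, ∑ j, if i < j ∧ σ j < σ i then (p i : ℤ) * p j else 0

/-- The exponent of the Koszul sign of the rearrangement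
`(a₁ ⊗ c₁) ⊗ ⋯ ⊗ (aₖ ⊗ cₖ) ↦ (a₁ ⊗ ⋯ ⊗ aₖ) ⊗ (c₁ ⊗ ⋯ ⊗ cₖ)`, where `aⱼ` has degree `p j` and `cⱼ` has
degree `q j`: the sum of `q i * p j` over all `i < j`. -/
def crossSign {n : ℕ} (p q : Fin n → ℕ) : ℤ :=
  ∑ i, ∑ j, if i < j then (q i : ℤ) * p j else 0

/-- The component of degree `z : ℤ` of an `ℕ`-graded vector space; it is zero in negative degrees. -/
def grZ {V : Type*} [AddCommGroup V] [Module K V] (gr : ℕ → Submodule K V) : ℤ → Submodule K V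
  | Int.ofNat q => gr q
  | Int.negSucc _ => ⊥

/-- The inputs `x₁, …, xᵢ₋₁, g (xᵢ, …, xᵢ₊ₙ₋₁), xᵢ₊ₙ, …` of `f` in the composite `f ∘ᵢ g`. -/
def insertBlock {V : Type*} {m n l : ℕ} (i : Fin m) (h : l + 1 = m + n) (g : (Fin n → V) → V)
    (x : Fin l → V) (j : Fin m) : V :=
  if hj : j = i then g fun t => x (splice i h (Sum.inr t)) else x (splice i h (Sum.inl ⟨j, hj⟩))

end Signs

/-- An algebra over the graded operad `P`: an `ℕ`-graded vector space `V` with a morphism of graded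
operads from `P` to the graded endomorphism operad of `V`. The structure of the latter (degree, unit,
partial compositions, right action) is spelled out on homogeneous inputs, with the Koszul signs. -/
structure PAlgebra {K : Type u} [Field K] (P : GradedOperad.{u, w} K) where
  V : Type u
  [addCommGroup : AddCommGroup V]
  [module : Module K V]
  /-- the homogeneous components of `V` -/
  gr : ℕ → Submodule K V
  [decomposition : DirectSum.Decomposition gr]
  /-- the structure maps `γₙ : P(n) → Hom(V^{⊗ n}, V)` -/
  act : ∀ n, P.obj n →ₗ[K] MultilinearMap K (fun _ : Fin n => V) V
  act_mem : ∀ {n : ℕ} (d : ℤ) (μ : P.obj n) (p : Fin n → ℕ) (x : Fin n → V), μ ∈ P.gr n d →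
    (∀ j, x j ∈ gr (p j)) → act n μ x ∈ grZ gr ((∑ j, (p j : ℤ)) + d)
  act_one : ∀ x : Fin 1 → V, act 1 P.one x = x 0
  act_comp : ∀ {m n l : ℕ} (i : Fin m) (h : l + 1 = m + n) (d : ℤ) (μ : P.obj m) (ν : P.obj n)
    (p : Fin l → ℕ) (x : Fin l → V), ν ∈ P.gr n d → (∀ j, x j ∈ gr (p j)) →
    act l (P.comp i h μ ν) x =
      (-1 : K) ^ (d * ∑ j : Fin l, if (j : ℕ) < i then (p j : ℤ) else 0) •
        act m μ (insertBlock i h (act n ν) x)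
  act_perm : ∀ {n : ℕ} (σ : Equiv.Perm (Fin n)) (μ : P.obj n) (p : Fin n → ℕ) (x : Fin n → V),
    (∀ j, x j ∈ gr (p j)) →
    act n (P.perm σ μ) x = (-1 : K) ^ permSign σ p • act n μ fun j => x (σ⁻¹ j)

attribute [instance] PAlgebra.addCommGroup PAlgebra.module PAlgebra.decomposition

namespace PAlgebra

variable {K : Type u} [Field K] {P : GradedOperad.{u, w} K}

/-- Morphisms of `P`-algebras: linear maps of degree `0` which commute with the operations. -/
@[ext]
structure Hom (A B : PAlgebra P) where
  toLin : A.V →ₗ[K] B.V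
  map_gr : ∀ (p : ℕ) (x : A.V), x ∈ A.gr p → toLin x ∈ B.gr p
  map_act : ∀ {n : ℕ} (μ : P.obj n) (x : Fin n → A.V),
    toLin (A.act n μ x) = B.act n μ fun j => toLin (x j)

instance : Category (PAlgebra P) where
  Hom A B := Hom A B
  id A := ⟨LinearMap.id, fun _ _ h => h, fun _ _ => rfl⟩
  comp f g := ⟨g.toLin ∘ₗ f.toLin, fun p x h => g.map_gr p _ (f.map_gr p x h), fun μ x => by
    simp [f.map_act, g.map_act]⟩

end PAlgebra

/-! ### Graded commutative algebras -/

/-- A graded commutative (unital, associative) `K`-algebra, graded by `ℕ`. -/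
structure GCAlg (K : Type u) [Field K] where
  R : Type u
  [ring : Ring R]
  [algebra : Algebra K R]
  /-- the homogeneous components of `R` -/
  gr : ℕ → Submodule K R
  [graded : GradedAlgebra gr]
  comm : ∀ (p q : ℕ) (a b : R), a ∈ gr p → b ∈ gr q → a * b = (-1 : K) ^ (p * q) • (b * a)

attribute [instance] GCAlg.ring GCAlg.algebra GCAlg.graded

namespace GCAlg

variable {K : Type u} [Field K]

/-- Morphisms of graded commutative algebras: unital algebra homomorphisms of degree `0`. -/
@[ext]
structure Hom (C D : GCAlg K) where
  toAlg : C.R →ₐ[K] D.R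
  map_gr : ∀ (p : ℕ) (x : C.R), x ∈ C.gr p → toAlg x ∈ D.gr p

instance : Category (GCAlg K) where
  Hom C D := Hom C D
  id C := ⟨AlgHom.id K C.R, fun _ _ h => h⟩
  comp f g := ⟨g.toAlg.comp f.toAlg, fun p x h => g.map_gr p _ (f.map_gr p x h)⟩

end GCAlg

/-! ### Auxiliary facts on signs -/

section SignLemmas

variable {K : Type u} [Field K]

theorem neg_one_zpow_congr {a b : ℤ} (h : Even (a - b)) : (-1 : K) ^ a = (-1 : K) ^ b := by
  have h1 : a = (a - b) + b := by ring
  rw [h1, zpow_add₀ (by simp), h.neg_one_zpow, one_mul]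

theorem neg_one_zpow_add (a b : ℤ) : (-1 : K) ^ (a + b) = (-1 : K) ^ a * (-1 : K) ^ b :=
  zpow_add₀ (by simp) a b

theorem neg_one_zpow_sum {ι : Type*} (s : Finset ι) (f : ι → ℤ) :
    (-1 : K) ^ (∑ i ∈ s, f i) = ∏ i ∈ s, (-1 : K) ^ f i := by
  classical
  induction s using Finset.induction_on with
  | empty => simp
  | insert a s ha ih => rw [Finset.sum_insert ha, Finset.prod_insert ha, neg_one_zpow_add, ih]

theorem even_sum_pairs {ι : Type*} [Fintype ι] [DecidableEq ι] (G : ι → ι → ℤ)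
    (h : ∀ i j, Even (G i j + G j i)) (hd : ∀ i, Even (G i i)) : Even (∑ i, ∑ j, G i j) := by
  rw [← ZMod.intCast_eq_zero_iff_even]
  push_cast
  rw [← Finset.sum_product' (f := fun i j => (G i j : ZMod 2))]
  refine Finset.sum_involution (fun a _ => (a.2, a.1)) ?_ ?_ (by simp) (by simp)
  · intro a _
    have := (ZMod.intCast_eq_zero_iff_even).2 (h a.1 a.2)
    push_cast at this
    exact this
  · rintro ⟨i, j⟩ _ hne he
    have : i = j := by
      have := congrArg Prod.snd he
      simpa using this
    subst this
    exact hne ((ZMod.intCast_eq_zero_iff_even).2 (hd i))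

theorem permSign_mul {n : ℕ} (σ τ : Equiv.Perm (Fin n)) (q : Fin n → ℕ) :
    Even (permSign (σ * τ) q - (permSign τ q + permSign σ fun j => q (τ⁻¹ j))) := by
  have h1 : (permSign σ fun j => q (τ⁻¹ j)) =
      ∑ i, ∑ j, if τ i < τ j ∧ σ (τ j) < σ (τ i) then (q i : ℤ) * q j else 0 := by
    unfold permSign
    rw [← Equiv.sum_comp τ]
    refine Finset.sum_congr rfl fun i _ => ?_
    rw [← Equiv.sum_comp τ]
    simp
  rw [h1]
  unfold permSign
  rw [← Finset.sum_add_distrib, ← Finset.sum_sub_distrib]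
  simp_rw [← Finset.sum_add_distrib, ← Finset.sum_sub_distrib]
  refine even_sum_pairs _ (fun i j => ?_) (fun i => by simp)
  simp only [Equiv.Perm.mul_apply]
  rcases lt_trichotomy i j with h | h | h
  · have h2 : ¬ j < i := not_lt.2 h.le
    have h3 : τ i ≠ τ j := fun e => h.ne (τ.injective e)
    have h4 : σ (τ i) ≠ σ (τ j) := fun e => h3 (σ.injective e)
    rcases lt_or_gt_of_ne h3 with h5 | h5 <;> rcases lt_or_gt_of_ne h4 with h6 | h6 <;>
      simp [h, h2, h5, h6, not_lt.2 h5.le, not_lt.2 h6.le, mul_comm, parity_simps]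
  · subst h; simp
  · have h2 : ¬ i < j := not_lt.2 h.le
    have h3 : τ i ≠ τ j := fun e => h.ne (τ.injective e).symm
    have h4 : σ (τ i) ≠ σ (τ j) := fun e => h3 (σ.injective e)
    rcases lt_or_gt_of_ne h3 with h5 | h5 <;> rcases lt_or_gt_of_ne h4 with h6 | h6 <;>
      simp [h, h2, h5, h6, not_lt.2 h5.le, not_lt.2 h6.le, mul_comm, parity_simps]

theorem permSign_crossSign {n : ℕ} (σ : Equiv.Perm (Fin n)) (p q : Fin n → ℕ) :
    Even ((crossSign p q + permSign σ p + permSign σ q) -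
      (permSign σ (fun j => p j + q j) +
        crossSign (fun j => p (σ⁻¹ j)) fun j => q (σ⁻¹ j))) := by
  have h1 : (crossSign (fun j => p (σ⁻¹ j)) fun j => q (σ⁻¹ j)) =
      ∑ i, ∑ j, if σ i < σ j then (q i : ℤ) * p j else 0 := by
    unfold crossSign
    rw [← Equiv.sum_comp σ]
    refine Finset.sum_congr rfl fun i _ => ?_
    rw [← Equiv.sum_comp σ]
    simp
  rw [h1]
  unfold permSign crossSign
  simp_rw [← Finset.sum_add_distrib, ← Finset.sum_sub_distrib]
  refine even_sum_pairs _ (fun i j => ?_) (fun i => by simp)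
  rcases lt_trichotomy i j with h | h | h
  · have h2 : ¬ j < i := not_lt.2 h.le
    have h3 : σ i ≠ σ j := fun e => h.ne (σ.injective e)
    rcases lt_or_gt_of_ne h3 with h5 | h5
    · simp [h, h2, h5, not_lt.2 h5.le]
    · simp only [h, h2, h5, not_lt.2 h5.le, and_self, if_true, if_false]
      refine ⟨- (p i * q j : ℤ), ?_⟩
      push_cast
      ring
  · subst h; simp
  · have h2 : ¬ i < j := not_lt.2 h.le
    have h3 : σ i ≠ σ j := fun e => h.ne (σ.injective e).symm
    rcases lt_or_gt_of_ne h3 with h5 | h5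
    · simp only [h, h2, h5, not_lt.2 h5.le, and_self, if_true, if_false]
      refine ⟨- (q i * p j : ℤ), ?_⟩
      push_cast
      ring
    · simp [h, h2, h5, not_lt.2 h5.le]

end SignLemmas

/-! ### Auxiliary facts on ordered products -/

section Products

variable {K : Type u} [Field K]

theorem prod_swap_succ {n : ℕ} (C : GCAlg K) (k : Fin n) (q : Fin (n + 1) → ℕ)
    (c : Fin (n + 1) → C.R) (hc : ∀ j, c j ∈ C.gr (q j)) :
    (List.ofFn c).prod = (-1 : K) ^ (q k.castSucc * q k.succ) •
      (List.ofFn fun j => c (Equiv.swap k.castSucc k.succ j)).prod := by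
  induction n with
  | zero => exact k.elim0
  | succ n ih =>
    refine Fin.cases ?_ (fun k => ?_) k
    · have h : ∀ j : Fin n, Equiv.swap (0 : Fin (n + 2)) 1 j.succ.succ = j.succ.succ := fun j =>
        Equiv.swap_apply_of_ne_of_ne (Fin.succ_ne_zero _)
          (fun e => Fin.succ_ne_zero j (Fin.succ_injective _ (by simpa using e)))
      have h2 := C.comm _ _ _ _ (hc 0) (hc 1)
      simp only [List.ofFn_succ, List.prod_cons, Fin.castSucc_zero, Fin.succ_zero_eq_one,
        Equiv.swap_apply_left, Equiv.swap_apply_right, h]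
      rw [← mul_assoc, h2, smul_mul_assoc, mul_assoc]
    · have h0 : Equiv.swap (k.succ.castSucc) (k.succ.succ) 0 = 0 :=
        Equiv.swap_apply_of_ne_of_ne (by simp [Fin.ext_iff]) (Fin.succ_ne_zero _).symm
      have h1 : ∀ j : Fin (n + 1), Equiv.swap (k.succ.castSucc) (k.succ.succ) j.succ =
          (Equiv.swap k.castSucc k.succ j).succ := fun j => by
        rw [← Fin.succ_castSucc]
        exact ((Fin.succ_injective _).swap_apply _ _ _)
      simp only [List.ofFn_succ (n := n + 1), List.prod_cons, h0, h1]
      rw [ih k (fun j => q j.succ) (fun j => c j.succ) (fun j => hc j.succ), mul_smul_comm]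
      rfl

theorem prod_perm {n : ℕ} (C : GCAlg K) (σ : Equiv.Perm (Fin n)) (q : Fin n → ℕ)
    (c : Fin n → C.R) (hc : ∀ j, c j ∈ C.gr (q j)) :
    (List.ofFn c).prod = (-1 : K) ^ permSign σ q • (List.ofFn fun j => c (σ⁻¹ j)).prod := by
  cases n with
  | zero => simp [permSign]
  | succ n =>
    have hσ : σ ∈ Submonoid.closure
        (Set.range fun i : Fin n => Equiv.swap i.castSucc i.succ) := by
      rw [Equiv.Perm.mclosure_swap_castSucc_succ]; trivial
    induction hσ using Submonoid.closure_induction generalizing q c with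
    | mem x hx =>
      obtain ⟨k, rfl⟩ := hx
      have h : permSign (Equiv.swap k.castSucc k.succ) q = q k.castSucc * q k.succ := by
        unfold permSign
        rw [Finset.sum_eq_single k.castSucc, Finset.sum_eq_single k.succ]
        · simp
        · intro j _ hj
          rw [if_neg]
          rintro ⟨h1, h2⟩
          rw [Equiv.swap_apply_left, Equiv.swap_apply_of_ne_of_ne h1.ne' hj] at h2
          simp [Fin.lt_def] at h1 h2
          omega
        · simp
        · intro i _ hi
          refine Finset.sum_eq_zero fun j _ => if_neg ?_
          rintro ⟨h1, h2⟩
          by_cases h3 : i = k.succ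
          · subst h3
            rw [Equiv.swap_apply_right, Equiv.swap_apply_of_ne_of_ne
              (by simp [Fin.ext_iff, Fin.lt_def] at h1 ⊢; omega) h1.ne'] at h2
            simp [Fin.lt_def] at h1 h2
            omega
          · rw [Equiv.swap_apply_of_ne_of_ne hi h3] at h2
            by_cases h4 : j = k.castSucc
            · subst h4
              rw [Equiv.swap_apply_left] at h2
              simp [Fin.lt_def] at h1 h2
              omega
            · by_cases h5 : j = k.succ
              · subst h5
                rw [Equiv.swap_apply_right] at h2
                simp [Fin.lt_def, Fin.ext_iff] at h1 h2 hi
                omega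
              · rw [Equiv.swap_apply_of_ne_of_ne h4 h5] at h2
                exact absurd h1 (not_lt.2 h2.le)
        · simp
      rw [prod_swap_succ C k q c hc, h, Equiv.swap_inv]
      norm_cast
    | one =>
      have h : permSign (1 : Equiv.Perm (Fin (n + 1))) q = 0 :=
        Finset.sum_eq_zero fun i _ => Finset.sum_eq_zero fun j _ =>
          if_neg fun h => lt_asymm h.1 h.2
      simp [h]
    | mul σ τ _ _ hσ hτ =>
      rw [hτ q c hc, hσ _ _ (fun j => hc (τ⁻¹ j)), smul_smul, ← neg_one_zpow_add,
        neg_one_zpow_congr (permSign_mul σ τ q)]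
      simp [mul_inv_rev]

end Products

/-! ### Auxiliary facts on partial composites -/

section Splice

variable {m n l : ℕ} (i : Fin m) (h : l + 1 = m + n)

theorem splice_inl (j : {j : Fin m // j ≠ i}) :
    (splice i h (Sum.inl j) : ℕ) = if (j.1 : ℕ) < i then (j.1 : ℕ) else (j.1 : ℕ) + n - 1 := by
  simp only [splice, Equiv.coe_fn_mk, Sum.elim_inl]
  split_ifs <;> rfl

theorem splice_inr (t : Fin n) : (splice i h (Sum.inr t) : ℕ) = i + t := rfl

theorem sum_splice (F : Fin l → ℤ) :
    ∑ s, F s = ∑ j, F (splice i h (Sum.inl j)) + ∑ t, F (splice i h (Sum.inr t)) := by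
  rw [← Equiv.sum_comp (splice i h), Fintype.sum_sum_type]

theorem crossSign_splice (d : ℤ) (p q : Fin l → ℕ) (p' q' : Fin m → ℕ)
    (hp : (p' i : ℤ) = (∑ t, (p (splice i h (Sum.inr t)) : ℤ)) + d)
    (hq : q' i = ∑ t, q (splice i h (Sum.inr t)))
    (hp' : ∀ j : {j : Fin m // j ≠ i}, p' j = p (splice i h (Sum.inl j)))
    (hq' : ∀ j : {j : Fin m // j ≠ i}, q' j = q (splice i h (Sum.inl j))) :
    crossSign p q + d * (∑ j : Fin l, if (j : ℕ) < i then (q j : ℤ) else 0) =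
      crossSign p' q' + crossSign (fun t => p (splice i h (Sum.inr t)))
        fun t => q (splice i h (Sum.inr t)) := by
  have ne : ∀ j : {j : Fin m // j ≠ i}, (j.1 : ℕ) ≠ i := fun j e => j.2 (Fin.ext e)
  have hll : ∀ j k : {j : Fin m // j ≠ i},
      (splice i h (Sum.inl j) < splice i h (Sum.inl k)) = (j.1 < k.1) := fun j k => by
    have h1 := ne j
    have h2 := ne k
    rw [Fin.lt_def, Fin.lt_def, splice_inl, splice_inl, eq_iff_iff]
    split_ifs <;> omega
  have hlr : ∀ (j : {j : Fin m // j ≠ i}) (t : Fin n),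
      (splice i h (Sum.inl j) < splice i h (Sum.inr t)) = (j.1 < i) := fun j t => by
    have h1 := ne j
    rw [Fin.lt_def, Fin.lt_def, splice_inl, splice_inr, eq_iff_iff]
    split_ifs <;> omega
  have hrl : ∀ (t : Fin n) (j : {j : Fin m // j ≠ i}),
      (splice i h (Sum.inr t) < splice i h (Sum.inl j)) = (i < j.1) := fun t j => by
    have h1 := ne j
    rw [Fin.lt_def, Fin.lt_def, splice_inl, splice_inr, eq_iff_iff]
    split_ifs <;> omega
  have hrr : ∀ t t' : Fin n,
      (splice i h (Sum.inr t) < splice i h (Sum.inr t')) = (t < t') := fun t t' => by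
    rw [Fin.lt_def, Fin.lt_def, splice_inr, splice_inr, eq_iff_iff]
    omega
  have hl : ∀ j : {j : Fin m // j ≠ i}, ((splice i h (Sum.inl j) : ℕ) < i) = (j.1 < i) := fun j => by
    have h1 := ne j
    rw [Fin.lt_def, splice_inl, eq_iff_iff]
    split_ifs <;> omega
  have hr : ∀ t : Fin n, ((splice i h (Sum.inr t) : ℕ) < i) = False := fun t => by
    rw [splice_inr]
    simp
  unfold crossSign
  simp only [sum_splice i h, hll, hlr, hrl, hrr, hl, hr, if_false, Finset.sum_const_zero, add_zero]
  simp only [Fintype.sum_eq_add_sum_subtype_ne _ i, hp, hq, hp', hq', lt_irrefl, if_false, zero_add]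
  simp only [Finset.sum_add_distrib, Finset.mul_sum]
  have e1 : ∀ j : {j : Fin m // j ≠ i},
      (if j.1 < i then (q (splice i h (Sum.inl j)) : ℤ) *
        ((∑ t, (p (splice i h (Sum.inr t)) : ℤ)) + d) else 0) =
      (∑ t, if j.1 < i then (q (splice i h (Sum.inl j)) : ℤ) * p (splice i h (Sum.inr t)) else 0) +
        d * (if j.1 < i then (q (splice i h (Sum.inl j)) : ℤ) else 0) := fun j => by
    split_ifs
    · rw [mul_add, Finset.mul_sum, mul_comm d]
    · simp
  have e2 : ∀ j : {j : Fin m // j ≠ i},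
      (if i < j.1 then ((∑ t, q (splice i h (Sum.inr t)) : ℕ) : ℤ) *
        p (splice i h (Sum.inl j)) else 0) =
      (∑ t, if i < j.1 then (q (splice i h (Sum.inr t)) : ℤ) * p (splice i h (Sum.inl j)) else 0) :=
      fun j => by
    split_ifs
    · push_cast
      rw [Finset.sum_mul]
    · simp
  simp only [e1, e2, Finset.sum_add_distrib]
  rw [Finset.sum_comm (s := (Finset.univ : Finset (Fin n)))
    (t := (Finset.univ : Finset {j : Fin m // j ≠ i}))]
  ring

theorem prod_insertBlock {R : Type*} [Ring R] (c : Fin l → R) :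
    (List.ofFn (insertBlock i h (fun v => (List.ofFn v).prod) c)).prod = (List.ofFn c).prod := by
  obtain ⟨i, hi⟩ := i
  obtain ⟨b, rfl⟩ : ∃ b, m = i + 1 + b := ⟨m - (i + 1), by omega⟩
  obtain rfl : l = i + n + b := by omega
  obtain ⟨g, hg⟩ : ∃ g : ℕ → R, ∀ s : Fin (i + n + b), c s = g s :=
    ⟨fun s => if hs : s < i + n + b then c ⟨s, hs⟩ else 1, fun s => by simp⟩
  have h1 : ∀ (N : ℕ) (f : ℕ → R), List.ofFn (fun s : Fin N => f s) = (List.range N).map f :=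
    fun N f => by
      rw [List.ofFn_eq_map, ← List.map_coe_finRange_eq_range, List.map_map]
      rfl
  obtain ⟨g', hg'⟩ : ∃ g' : ℕ → R, ∀ j, g' j = if j < i then g j else
      if j = i then ((List.range n).map fun t => g (i + t)).prod else g (j + n - 1) :=
    ⟨_, fun _ => rfl⟩
  have h2 : insertBlock ⟨i, hi⟩ h (fun v => (List.ofFn v).prod) c =
      fun j : Fin (i + 1 + b) => g' j := by
    funext j
    rw [hg']
    unfold insertBlock
    by_cases hj : j = ⟨i, hi⟩
    · have hj' : (j : ℕ) = i := congrArg Fin.val hj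
      simp only [hj, dite_true, lt_irrefl, if_false, if_true]
      rw [← h1]
      simp only [hg, splice_inr]
    · have hj' : (j : ℕ) ≠ i := fun e => hj (Fin.ext e)
      simp only [hj, dite_false, hj', if_false, hg, splice_inl]
      split_ifs <;> rfl
  have h3 : c = fun s : Fin (i + n + b) => g s := funext hg
  rw [h2, h1, h3, h1, List.range_add, List.range_add, List.range_add,
    List.range_add]
  simp only [List.map_append, List.map_map, List.prod_append]
  have h4 : ∀ k, ¬ (i + 1 + k < i) := fun k => by omega
  have h5 : ∀ k, ¬ (i + 1 + k = i) := fun k => by omega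
  have h6 : ∀ k, i + 1 + k + n - 1 = i + n + k := fun k => by omega
  have h7 : (List.range i).map g' = (List.range i).map g :=
    List.map_congr_left fun a ha => by
      rw [List.mem_range] at ha
      simp [hg', ha]
  rw [h7]
  simp [hg', Function.comp_def, h4, h5, h6]

variable {K : Type u} [Field K] {V : Type*} [AddCommGroup V] [Module K V]

theorem insertBlock_update (g : MultilinearMap K (fun _ : Fin n => V) V) (x : Fin l → V)
    (s : Fin l) : ∃ (j : Fin m) (L : V →ₗ[K] V), ∀ v : V,
      insertBlock i h g (Function.update x s v) =
        Function.update (insertBlock i h g x) j (L v) := by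
  obtain ⟨s, rfl⟩ := (splice i h).surjective s
  rcases s with ⟨j, hj⟩ | t
  · refine ⟨j, LinearMap.id, fun v => funext fun k => ?_⟩
    by_cases hk : k = j
    · subst hk
      simp [insertBlock, hj]
    · rw [Function.update_of_ne hk]
      unfold insertBlock
      by_cases hi : k = i
      · simp only [hi, dite_true]
        congr 1
        funext t
        rw [Function.update_of_ne (by simp)]
      · simp only [hi, dite_false]
        rw [Function.update_of_ne (by simpa using hk)]
  · refine ⟨i, g.toLinearMap (fun t => x (splice i h (Sum.inr t))) t, fun v => funext fun k => ?_⟩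
    by_cases hk : k = i
    · subst hk
      simp only [insertBlock, dite_true, Function.update_self, MultilinearMap.toLinearMap_apply]
      congr 1
      funext t'
      by_cases ht : t' = t
      · subst ht; simp
      · rw [Function.update_of_ne ht, Function.update_of_ne (by simpa using ht)]
    · rw [Function.update_of_ne hk]
      simp only [insertBlock, hk, dite_false]
      rw [Function.update_of_ne (by simp)]

/-- The composite `f ∘ᵢ g` of multilinear maps, without sign. -/
def insertMultilinear (f : MultilinearMap K (fun _ : Fin m => V) V)
    (g : MultilinearMap K (fun _ : Fin n => V) V) : MultilinearMap K (fun _ : Fin l => V) V :=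
  MultilinearMap.mk' (fun x => f (insertBlock i h g x))
    (fun x s v w => by
      obtain ⟨j, L, hL⟩ := insertBlock_update i h g x s
      simp [hL])
    (fun x s r v => by
      obtain ⟨j, L, hL⟩ := insertBlock_update i h g x s
      simp [hL])

end Splice

section Span

variable {K : Type u} [Field K] {V M : Type*} [AddCommGroup V] [Module K V]
  [AddCommGroup M] [Module K M]

theorem multilinear_mem_of_span {n : ℕ} (f : MultilinearMap K (fun _ : Fin n => V) M)
    (W : Submodule K M) (S : Fin n → Set V) (h : ∀ x : Fin n → V, (∀ j, x j ∈ S j) → f x ∈ W)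
    (x : Fin n → V) (hx : ∀ j, x j ∈ Submodule.span K (S j)) : f x ∈ W := by
  have key : ∀ s : Finset (Fin n), ∀ x : Fin n → V, (∀ j ∈ s, x j ∈ Submodule.span K (S j)) →
      (∀ j ∉ s, x j ∈ S j) → f x ∈ W := by
    intro s
    induction s using Finset.induction_on with
    | empty => exact fun x _ hx => h x fun j => hx j (by simp)
    | insert a s ha ih =>
      intro x h1 h2
      have h3 : ∀ y ∈ Submodule.span K (S a), f (Function.update x a y) ∈ W := by
        intro y hy
        induction hy using Submodule.span_induction with
        | mem y hy =>
          refine ih _ (fun j hj => ?_) fun j hj => ?_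
          · rw [Function.update_of_ne (by rintro rfl; exact ha hj)]
            exact h1 j (Finset.mem_insert_of_mem hj)
          · by_cases e : j = a
            · subst e; simpa using hy
            · rw [Function.update_of_ne e]
              exact h2 j (by simp [e, hj])
        | zero => simp
        | add y z _ _ hy hz => rw [f.map_update_add]; exact W.add_mem hy hz
        | smul r y _ hy => rw [f.map_update_smul]; exact W.smul_mem r hy
      simpa using h3 (x a) (h1 a (Finset.mem_insert_self _ _))
  exact key Finset.univ x (fun j _ => hx j) (by simp)

theorem multilinear_eq_of_span {n : ℕ} (f g : MultilinearMap K (fun _ : Fin n => V) M)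
    (S : Fin n → Set V) (h : ∀ x : Fin n → V, (∀ j, x j ∈ S j) → f x = g x)
    (x : Fin n → V) (hx : ∀ j, x j ∈ Submodule.span K (S j)) : f x = g x := by
  have := multilinear_mem_of_span (f - g) ⊥ S (fun x hx => by simp [h x hx]) x hx
  simpa [sub_eq_zero] using this

end Span

/-! ### Extension of a multilinear map along a graded commutative algebra -/

section TensorExt

variable {K : Type u} [Field K] {V M : Type*} [AddCommGroup V] [Module K V]
  [AddCommGroup M] [Module K M]

/-- The linear map that multiplies the elements of degree `p` by the scalar `r p`. -/
noncomputable def degreeScale (gr : ℕ → Submodule K V) [DirectSum.Decomposition gr] (r : ℕ → K) :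
    V →ₗ[K] V :=
  (DirectSum.toModule K ℕ V fun p => r p • (gr p).subtype) ∘ₗ
    (DirectSum.decomposeLinearEquiv gr).toLinearMap

theorem degreeScale_apply (gr : ℕ → Submodule K V) [DirectSum.Decomposition gr] (r : ℕ → K) {p : ℕ}
    {x : V} (hx : x ∈ gr p) : degreeScale gr r x = r p • x := by
  change DirectSum.toModule K ℕ V (fun p => r p • (gr p).subtype) (DirectSum.decompose gr x) = _
  rw [DirectSum.decompose_of_mem gr hx, ← DirectSum.lof_eq_of K, DirectSum.toModule_lof]
  simp

variable (gr : ℕ → Submodule K V) [DirectSum.Decomposition gr] (C : GCAlg K)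

/-- For `c` of even degree, left multiplication of the values of `F` by `c`; for `c` of odd degree,
the same with the sign `(-1)^(p₁ + ⋯ + pₙ)` on inputs with `V`-components of degrees `pⱼ`. -/
noncomputable def tensorStep (n : ℕ) :
    C.R →ₗ[K] MultilinearMap K (fun _ : Fin n => V ⊗[K] C.R) (M ⊗[K] C.R) →ₗ[K]
      MultilinearMap K (fun _ : Fin n => V ⊗[K] C.R) (M ⊗[K] C.R) :=
  LinearMap.mk₂ K
    (fun c F =>
      ((LinearMap.mul K C.R (degreeScale C.gr (fun p => if Even p then 1 else 0) c)).lTensor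
        M).compMultilinearMap F +
      ((LinearMap.mul K C.R (degreeScale C.gr (fun p => if Even p then 0 else 1) c)).lTensor
        M).compMultilinearMap
          (F.compLinearMap fun _ => (degreeScale gr fun p => (-1) ^ p).rTensor C.R))
    (fun c c' F => by
      ext x; simp [LinearMap.lTensor_add]; abel)
    (fun r c F => by
      ext x; simp [LinearMap.lTensor_smul])
    (fun c F F' => by
      ext x; simp; abel)
    (fun r c F => by
      ext x; simp)

/-- The multilinear map `(V ⊗ C)ⁿ → M ⊗ C` induced by a multilinear map `g : Vⁿ → M`, which sends
`(a₁ ⊗ c₁, …, aₙ ⊗ cₙ)` to `± g (a₁, …, aₙ) ⊗ c₁ ⋯ cₙ` with the Koszul sign of the rearrangement, see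
`tensorExt_tmul`. -/
noncomputable def tensorExt : ∀ n : ℕ, MultilinearMap K (fun _ : Fin n => V) M →ₗ[K]
    MultilinearMap K (fun _ : Fin n => V ⊗[K] C.R) (M ⊗[K] C.R)
  | 0 =>
    { toFun := fun g => MultilinearMap.constOfIsEmpty K _ (g 0 ⊗ₜ[K] 1)
      map_add' := fun g g' => by ext; simp [add_tmul]
      map_smul' := fun r g => by ext; simp [smul_tmul'] }
  | n + 1 =>
    { toFun := fun g => LinearMap.uncurryLeft
        (TensorProduct.lift ((tensorStep gr C n).flip ∘ₗ tensorExt n ∘ₗ g.curryLeft))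
      map_add' := fun g g' => by
        have h : (g + g').curryLeft = g.curryLeft + g'.curryLeft := rfl
        rw [h, LinearMap.comp_add, LinearMap.comp_add]
        have h2 : ∀ F G : V →ₗ[K] C.R →ₗ[K] MultilinearMap K (fun _ : Fin n => V ⊗[K] C.R)
            (M ⊗[K] C.R), TensorProduct.lift (F + G) =
              TensorProduct.lift F + TensorProduct.lift G := fun F G => by ext; simp
        rw [h2]
        rfl
      map_smul' := fun r g => by
        have h : (r • g).curryLeft = r • g.curryLeft := rfl
        rw [h, LinearMap.comp_smul, LinearMap.comp_smul]
        have h2 : ∀ F : V →ₗ[K] C.R →ₗ[K] MultilinearMap K (fun _ : Fin n => V ⊗[K] C.R)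
            (M ⊗[K] C.R), TensorProduct.lift (r • F) = r • TensorProduct.lift F :=
          fun F => by ext; simp
        rw [h2]
        rfl }

theorem tensorExt_tmul {n : ℕ} (g : MultilinearMap K (fun _ : Fin n => V) M) (p q : Fin n → ℕ)
    (a : Fin n → V) (c : Fin n → C.R) (ha : ∀ j, a j ∈ gr (p j)) (hc : ∀ j, c j ∈ C.gr (q j)) :
    tensorExt gr C n g (fun j => a j ⊗ₜ c j) =
      (-1 : K) ^ crossSign p q • (g a ⊗ₜ[K] (List.ofFn c).prod) := by
  induction n with
  | zero => simp [tensorExt, crossSign, Subsingleton.elim a 0]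
  | succ n ih =>
    have := ih (g.curryLeft (a 0)) (fun j => p j.succ) (fun j => q j.succ) (fun j => a j.succ)
      (fun j => c j.succ) (fun j => ha j.succ) (fun j => hc j.succ)
    have hs : crossSign p q = q 0 * (∑ j : Fin n, (p j.succ : ℤ)) +
        crossSign (fun j => p j.succ) fun j => q j.succ := by
      simp [crossSign, Fin.sum_univ_succ, Finset.mul_sum]
    have ht : ∀ j, (degreeScale gr fun p => (-1) ^ p).rTensor C.R (a j ⊗ₜ[K] c j) =
        (-1 : K) ^ p j • (a j ⊗ₜ[K] c j) := fun j => by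
      rw [LinearMap.rTensor_tmul, degreeScale_apply gr _ (ha j), smul_tmul']
    have hcons : Fin.cons (a 0) (fun j : Fin n => a j.succ) = a := Fin.cons_self_tail a
    have h1 : tensorExt gr C (n + 1) g (fun j => a j ⊗ₜ c j) =
        tensorStep gr C n (c 0) (tensorExt gr C n (g.curryLeft (a 0)))
          (fun j => a j.succ ⊗ₜ c j.succ) := rfl
    rw [h1, List.ofFn_succ, List.prod_cons, hs, neg_one_zpow_add]
    simp only [tensorStep, LinearMap.mk₂_apply, add_apply,
      LinearMap.compMultilinearMap_apply, MultilinearMap.compLinearMap_apply, ht,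
      MultilinearMap.map_smul_univ, this, degreeScale_apply C.gr _ (hc 0), map_smul,
      LinearMap.lTensor_tmul, MultilinearMap.curryLeft_apply, hcons]
    by_cases he : Even (q 0)
    · have he' : Even ((q 0 : ℤ) * ∑ j : Fin n, (p j.succ : ℤ)) :=
        ((Int.even_coe_nat (q 0)).2 he).mul_right _
      simp [he, he'.neg_one_zpow]
    · have ho : Even ((q 0 : ℤ) - 1) := by
        rw [Int.even_sub_one, Int.even_coe_nat]; exact he
      have hc : (-1 : K) ^ ((q 0 : ℤ) * ∑ j : Fin n, (p j.succ : ℤ)) = ∏ j : Fin n, (-1) ^ p j.succ := by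
        rw [neg_one_zpow_congr (b := ∑ j : Fin n, (p j.succ : ℤ)), neg_one_zpow_sum]
        · simp
        · convert ho.mul_right (∑ j : Fin n, (p j.succ : ℤ)) using 1
          ring
      simp [he, hc, smul_smul]

end TensorExt

/-! ### The functor `A ⊗ -` -/

section Tensor

variable {K : Type u} [Field K]

/-- The elements `a ⊗ c` with `a` and `c` homogeneous of total degree `n`. -/
def pureTensors {V : Type u} [AddCommGroup V] [Module K V] (gr : ℕ → Submodule K V) (C : GCAlg K)
    (n : ℕ) : Set (V ⊗[K] C.R) :=
  {t | ∃ (p q : ℕ) (a : V) (c : C.R), p + q = n ∧ a ∈ gr p ∧ c ∈ C.gr q ∧ a ⊗ₜ[K] c = t}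

/-- The total grading of `V ⊗ C`. -/
def tensorGr {V : Type u} [AddCommGroup V] [Module K V] (gr : ℕ → Submodule K V) (C : GCAlg K)
    (n : ℕ) : Submodule K (V ⊗[K] C.R) :=
  Submodule.span K (pureTensors gr C n)

section

variable {V : Type u} [AddCommGroup V] [Module K V] (gr : ℕ → Submodule K V) (C : GCAlg K)

theorem tmul_mem_tensorGr {p q n : ℕ} (h : p + q = n) {a : V} {c : C.R} (ha : a ∈ gr p)
    (hc : c ∈ C.gr q) : a ⊗ₜ[K] c ∈ tensorGr gr C n :=
  Submodule.subset_span ⟨p, q, a, c, h, ha, hc, rfl⟩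

/-- The bilinear map `V_p × C_q → (V ⊗ C)_{p + q}`, followed by the inclusion. -/
noncomputable def tensorPiece (p q : ℕ) :
    gr p →ₗ[K] C.gr q →ₗ[K] DirectSum ℕ fun n => tensorGr gr C n :=
  LinearMap.mk₂ K
    (fun a c => DirectSum.lof K ℕ (fun n => tensorGr gr C n) (p + q)
      ⟨(a : V) ⊗ₜ[K] (c : C.R), tmul_mem_tensorGr gr C rfl a.2 c.2⟩)
    (fun a a' c => by rw [← map_add]; congr 1; ext; simp [add_tmul])
    (fun r a c => by rw [← map_smul]; congr 1)
    (fun a c c' => by rw [← map_add]; congr 1; ext; simp [tmul_add])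
    (fun r a c => by rw [← map_smul]; congr 1; ext; simp)

variable [DirectSum.Decomposition gr]

/-- The decomposition of the elements of `V ⊗ C` into homogeneous components. -/
noncomputable def tensorDecompose : V ⊗[K] C.R →ₗ[K] DirectSum ℕ fun n => tensorGr gr C n :=
  TensorProduct.lift
    (((DirectSum.toModule K ℕ _ fun p =>
        (DirectSum.toModule K ℕ _ fun q => (tensorPiece gr C p q).flip).flip).compl₂
          (DirectSum.decomposeLinearEquiv C.gr).toLinearMap) ∘ₗ
        (DirectSum.decomposeLinearEquiv gr).toLinearMap)

theorem tensorDecompose_tmul {p q : ℕ} {a : V} {c : C.R} (ha : a ∈ gr p) (hc : c ∈ C.gr q) :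
    tensorDecompose gr C (a ⊗ₜ c) = DirectSum.lof K ℕ (fun n => tensorGr gr C n) (p + q)
      ⟨a ⊗ₜ[K] c, tmul_mem_tensorGr gr C rfl ha hc⟩ := by
  have h1 : tensorDecompose gr C (a ⊗ₜ c) = (DirectSum.toModule K ℕ _ fun p =>
        (DirectSum.toModule K ℕ _ fun q => (tensorPiece gr C p q).flip).flip)
          (DirectSum.decompose gr a) (DirectSum.decompose C.gr c) := rfl
  rw [h1, DirectSum.decompose_of_mem gr ha, DirectSum.decompose_of_mem C.gr hc,
    ← DirectSum.lof_eq_of K, ← DirectSum.lof_eq_of K, DirectSum.toModule_lof, LinearMap.flip_apply,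
    DirectSum.toModule_lof]
  rfl

theorem tensorDecompose_of_mem {n : ℕ} (x : tensorGr gr C n) :
    tensorDecompose gr C x = DirectSum.lof K ℕ (fun n => tensorGr gr C n) n x := by
  obtain ⟨x, hx⟩ := x
  have hx' := hx
  unfold tensorGr at hx'
  induction hx' using Submodule.span_induction with
  | mem x h =>
    obtain ⟨p, q, a, c, rfl, ha, hc, rfl⟩ := h
    exact tensorDecompose_tmul gr C ha hc
  | zero =>
    simp only [map_zero]
    exact (map_zero _).symm
  | add x y hx1 hy1 hx2 hy2 =>
    simp only [map_add]
    rw [hx2 hx1, hy2 hy1, ← map_add]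
    rfl
  | smul r x hx1 hx2 =>
    simp only [map_smul]
    rw [hx2 hx1, ← map_smul]
    rfl

noncomputable instance tensorDecomposition : DirectSum.Decomposition (tensorGr gr C) :=
  DirectSum.Decomposition.ofLinearMap (tensorGr gr C) (tensorDecompose gr C)
    (by
      ext a c
      simp only [AlgebraTensorModule.curry_apply, LinearMap.restrictScalars_self, curry_apply,
        LinearMap.comp_apply, LinearMap.id_apply]
      induction a using DirectSum.Decomposition.inductionOn gr with
      | zero => simp
      | add a a' ha ha' => rw [add_tmul, map_add, map_add, ha, ha']
      | @homogeneous p a =>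
        induction c using DirectSum.Decomposition.inductionOn C.gr with
        | zero => simp
        | add c c' hc hc' => rw [tmul_add, map_add, map_add, hc, hc']
        | @homogeneous q c =>
          rw [tensorDecompose_tmul gr C a.2 c.2, DirectSum.coeLinearMap_lof])
    (by
      ext n x : 2
      simp only [LinearMap.comp_apply, DirectSum.coeLinearMap_lof, LinearMap.id_apply]
      exact tensorDecompose_of_mem gr C x)

end

variable {P : GradedOperad.{u, w} K}

theorem grZ_natCast {V : Type*} [AddCommGroup V] [Module K V] (gr : ℕ → Submodule K V) {z : ℤ}
    {q : ℕ} (h : z = q) : grZ gr z = gr q := by subst h; rfl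

theorem tensorAct_mem (A : PAlgebra P) (C : GCAlg K) {n : ℕ} (d : ℤ) (μ : P.obj n)
    (r : Fin n → ℕ) (x : Fin n → A.V ⊗[K] C.R) (hμ : μ ∈ P.gr n d)
    (hx : ∀ j, x j ∈ tensorGr A.gr C (r j)) :
    tensorExt A.gr C n (A.act n μ) x ∈ grZ (tensorGr A.gr C) ((∑ j, (r j : ℤ)) + d) := by
  refine multilinear_mem_of_span _ _ _ (fun x hx => ?_) x hx
  choose p q a c hr ha hc hx using hx
  obtain rfl : x = fun j => a j ⊗ₜ c j := funext fun j => (hx j).symm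
  rw [tensorExt_tmul A.gr C (A.act n μ) p q a c ha hc]
  refine Submodule.smul_mem _ _ ?_
  have h1 := A.act_mem d μ p a hμ ha
  have h2 : (List.ofFn c).prod ∈ C.gr (∑ j, q j) := by
    have := SetLike.list_prod_ofFn_mem_graded (A := C.gr) q c hc
    rwa [List.sum_ofFn] at this
  have h3 : (∑ j, (r j : ℤ)) = ∑ j, (p j : ℤ) + ((∑ j, q j : ℕ) : ℤ) := by
    push_cast
    rw [← Finset.sum_add_distrib]
    exact Finset.sum_congr rfl fun j _ => by rw [← hr j]; push_cast; rfl
  rcases hz : (∑ j, (p j : ℤ)) + d with z | z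
  · rw [hz] at h1
    rw [grZ_natCast (tensorGr A.gr C) (q := z + ∑ j, q j)]
    · exact tmul_mem_tensorGr A.gr C rfl h1 h2
    · rw [h3]
      rw [Int.ofNat_eq_natCast] at hz
      push_cast at hz ⊢
      linarith
  · rw [hz] at h1
    have h4 : A.act n μ a = 0 := h1
    rw [h4, zero_tmul]
    exact Submodule.zero_mem _

theorem tensorAct_one (A : PAlgebra P) (C : GCAlg K) (x : Fin 1 → A.V ⊗[K] C.R) :
    tensorExt A.gr C 1 (A.act 1 P.one) x = x 0 := by
  have hx : ∀ j, x j ∈ Submodule.span K (⋃ n, pureTensors A.gr C n) := fun j => by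
    have h : ∀ t : A.V ⊗[K] C.R, t ∈ Submodule.span K (⋃ n, pureTensors A.gr C n) := fun t => by
      induction t using DirectSum.Decomposition.inductionOn (tensorGr A.gr C) with
      | zero => exact Submodule.zero_mem _
      | add a b ha hb => exact Submodule.add_mem _ ha hb
      | @homogeneous n a => exact Submodule.span_mono (Set.subset_iUnion _ n) a.2
    exact h (x j)
  refine multilinear_eq_of_span (tensorExt A.gr C 1 (A.act 1 P.one))
    ((MultilinearMap.ofSubsingleton K (A.V ⊗[K] C.R) (A.V ⊗[K] C.R) (0 : Fin 1)) LinearMap.id)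
    _ (fun x hx => ?_) x hx
  simp only [Set.mem_iUnion] at hx
  choose n p q a c hr ha hc hx using hx
  obtain rfl : x = fun j => a j ⊗ₜ c j := funext fun j => (hx j).symm
  rw [tensorExt_tmul A.gr C _ p q a c ha hc, A.act_one]
  simp [crossSign]

theorem tensorAct_perm (A : PAlgebra P) (C : GCAlg K) {n : ℕ} (σ : Equiv.Perm (Fin n))
    (μ : P.obj n) (r : Fin n → ℕ) (x : Fin n → A.V ⊗[K] C.R)
    (hx : ∀ j, x j ∈ tensorGr A.gr C (r j)) :
    tensorExt A.gr C n (A.act n (P.perm σ μ)) x =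
      (-1 : K) ^ permSign σ r • tensorExt A.gr C n (A.act n μ) fun j => x (σ⁻¹ j) := by
  refine multilinear_eq_of_span (tensorExt A.gr C n (A.act n (P.perm σ μ)))
    ((-1 : K) ^ permSign σ r • (tensorExt A.gr C n (A.act n μ)).domDomCongr σ⁻¹)
    _ (fun x hx => ?_) x hx
  choose p q a c hr ha hc hx using hx
  obtain rfl : x = fun j => a j ⊗ₜ c j := funext fun j => (hx j).symm
  obtain rfl : (fun j => p j + q j) = r := funext hr
  rw [smul_apply, MultilinearMap.domDomCongr_apply,
    tensorExt_tmul A.gr C _ p q a c ha hc, A.act_perm σ μ p a ha, prod_perm C σ q c hc,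
    tensorExt_tmul A.gr C _ (fun j => p (σ⁻¹ j)) (fun j => q (σ⁻¹ j)) (fun j => a (σ⁻¹ j))
      (fun j => c (σ⁻¹ j)) (fun j => ha _) (fun j => hc _), ← smul_tmul', tmul_smul,
    smul_smul, smul_smul, smul_smul, ← neg_one_zpow_add, ← neg_one_zpow_add, ← neg_one_zpow_add,
    neg_one_zpow_congr (permSign_crossSign σ p q)]

theorem tensorAct_comp (A : PAlgebra P) (C : GCAlg K) {m n l : ℕ} (i : Fin m)
    (h : l + 1 = m + n) (d : ℤ) (μ : P.obj m) (ν : P.obj n) (r : Fin l → ℕ)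
    (x : Fin l → A.V ⊗[K] C.R) (hν : ν ∈ P.gr n d) (hx : ∀ j, x j ∈ tensorGr A.gr C (r j)) :
    tensorExt A.gr C l (A.act l (P.comp i h μ ν)) x =
      (-1 : K) ^ (d * ∑ j : Fin l, if (j : ℕ) < i then (r j : ℤ) else 0) •
        tensorExt A.gr C m (A.act m μ) (insertBlock i h (tensorExt A.gr C n (A.act n ν)) x) := by
  refine multilinear_eq_of_span (tensorExt A.gr C l (A.act l (P.comp i h μ ν)))
    ((-1 : K) ^ (d * ∑ j : Fin l, if (j : ℕ) < i then (r j : ℤ) else 0) •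
      insertMultilinear i h (tensorExt A.gr C m (A.act m μ)) (tensorExt A.gr C n (A.act n ν)))
    _ (fun x hx => ?_) x hx
  choose p q a c hr ha hc hx using hx
  obtain rfl : x = fun j => a j ⊗ₜ c j := funext fun j => (hx j).symm
  obtain rfl : (fun j => p j + q j) = r := funext hr
  -- the inputs of the outer operation
  set s : K := (-1 : K) ^ crossSign (fun t => p (splice i h (Sum.inr t)))
    (fun t => q (splice i h (Sum.inr t))) with hs
  set a' : Fin m → A.V := insertBlock i h (A.act n ν) a with ha'
  set c' : Fin m → C.R := insertBlock i h (fun v => (List.ofFn v).prod) c with hc'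
  have hins : insertBlock i h (tensorExt A.gr C n (A.act n ν)) (fun j => a j ⊗ₜ c j) =
      Function.update (fun j => a' j ⊗ₜ[K] c' j) i (s • (a' i ⊗ₜ[K] c' i)) := by
    funext j
    by_cases hj : j = i
    · subst hj
      simp only [insertBlock, ha', hc', dite_true, Function.update_self]
      exact tensorExt_tmul A.gr C (A.act n ν) _ _ _ _ (fun t => ha _) (fun t => hc _)
    · rw [Function.update_of_ne hj]
      simp [insertBlock, ha', hc', hj]
  have hR : insertMultilinear i h (tensorExt A.gr C m (A.act m μ))
      (tensorExt A.gr C n (A.act n ν)) (fun j => a j ⊗ₜ c j) =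
      s • tensorExt A.gr C m (A.act m μ) (fun j => a' j ⊗ₜ[K] c' j) := by
    change tensorExt A.gr C m (A.act m μ)
      (insertBlock i h (tensorExt A.gr C n (A.act n ν)) (fun j => a j ⊗ₜ c j)) = _
    rw [hins, MultilinearMap.map_update_smul, Function.update_eq_self]
  rw [smul_apply, hR, tensorExt_tmul A.gr C _ p q a c ha hc,
    A.act_comp i h d μ ν p a hν ha, ← ha', ← prod_insertBlock i h c, ← hc']
  have hmem := A.act_mem d ν (fun t => p (splice i h (Sum.inr t)))
    (fun t => a (splice i h (Sum.inr t))) hν (fun t => ha _)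
  have hai : a' i = A.act n ν fun t => a (splice i h (Sum.inr t)) := by
    simp [ha', insertBlock]
  rcases hz : (∑ t, (p (splice i h (Sum.inr t)) : ℤ)) + d with z | z
  · rw [hz] at hmem
    set p' : Fin m → ℕ := fun j => if hj : j = i then z else p (splice i h (Sum.inl ⟨j, hj⟩)) with hp'
    set q' : Fin m → ℕ := fun j => if hj : j = i then ∑ t, q (splice i h (Sum.inr t)) else
      q (splice i h (Sum.inl ⟨j, hj⟩)) with hq'
    have hap : ∀ j, a' j ∈ A.gr (p' j) := fun j => by
      by_cases hj : j = i
      · subst hj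
        rw [hai]
        have hm : A.act n ν (fun t => a (splice j h (Sum.inr t))) ∈ A.gr z := hmem
        simpa [hp'] using hm
      · simp only [ha', hp', insertBlock, hj, dite_false]
        exact ha _
    have hcq : ∀ j, c' j ∈ C.gr (q' j) := fun j => by
      by_cases hj : j = i
      · subst hj
        simp only [hc', hq', insertBlock, dite_true]
        have := SetLike.list_prod_ofFn_mem_graded (A := C.gr)
          (fun t => q (splice j h (Sum.inr t))) (fun t => c (splice j h (Sum.inr t)))
          (fun t => hc _)
        rwa [List.sum_ofFn] at this
      · simp only [hc', hq', insertBlock, hj, dite_false]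
        exact hc _
    have hcross := crossSign_splice i h d p q p' q' (by simp [hp', hz]) (by simp [hq'])
      (fun j => by simp [hp', j.2]) (fun j => by simp [hq', j.2])
    rw [tensorExt_tmul A.gr C _ p' q' a' c' hap hcq, ← smul_tmul', smul_smul, smul_smul, smul_smul,
      hs, ← neg_one_zpow_add, ← neg_one_zpow_add, ← neg_one_zpow_add]
    congr 1
    apply neg_one_zpow_congr
    have hsum : (∑ j : Fin l, if (j : ℕ) < i then ((p j + q j : ℕ) : ℤ) else 0) =
        (∑ j : Fin l, if (j : ℕ) < i then (p j : ℤ) else 0) +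
          ∑ j : Fin l, if (j : ℕ) < i then (q j : ℤ) else 0 := by
      rw [← Finset.sum_add_distrib]
      exact Finset.sum_congr rfl fun j _ => by split_ifs <;> simp
    rw [hsum]
    refine ⟨-(d * ∑ j : Fin l, if (j : ℕ) < i then (q j : ℤ) else 0), ?_⟩
    linarith
  · rw [hz] at hmem
    have h0 : a' i = 0 := by rw [hai]; exact hmem
    rw [(A.act m μ).map_coord_zero i h0]
    rw [(tensorExt A.gr C m (A.act m μ)).map_coord_zero i (by simp [h0])]
    simp

/-- The `P`-algebra `A ⊗ C`. -/
noncomputable def tensorObj (A : PAlgebra P) (C : GCAlg K) : PAlgebra P where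
  V := A.V ⊗[K] C.R
  gr := tensorGr A.gr C
  act n := tensorExt A.gr C n ∘ₗ A.act n
  act_mem d μ r x hμ hx := tensorAct_mem A C d μ r x hμ hx
  act_one x := tensorAct_one A C x
  act_comp i h d μ ν r x hν hx := tensorAct_comp A C i h d μ ν r x hν hx
  act_perm σ μ r x hx := tensorAct_perm A C σ μ r x hx

/-- The operations of `A ⊗ C` on homogeneous elements. -/
theorem tensorObj_act_tmul (A : PAlgebra P) (C : GCAlg K) {n : ℕ} (μ : P.obj n) (p q : Fin n → ℕ)
    (a : Fin n → A.V) (c : Fin n → C.R) (ha : ∀ j, a j ∈ A.gr (p j))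
    (hc : ∀ j, c j ∈ C.gr (q j)) :
    (tensorObj A C).act n μ (fun j => a j ⊗ₜ[K] c j) =
      (-1 : K) ^ crossSign p q • (A.act n μ a ⊗ₜ[K] (List.ofFn c).prod) :=
  tensorExt_tmul A.gr C (A.act n μ) p q a c ha hc

theorem tensorMap_act (A : PAlgebra P) {C D : GCAlg K} (φ : C ⟶ D) {n : ℕ} (μ : P.obj n)
    (x : Fin n → A.V ⊗[K] C.R) :
    φ.toAlg.toLinearMap.lTensor A.V (tensorExt A.gr C n (A.act n μ) x) =
      tensorExt A.gr D n (A.act n μ) fun j => φ.toAlg.toLinearMap.lTensor A.V (x j) := by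
  have hx : ∀ j, x j ∈ Submodule.span K (⋃ n, pureTensors A.gr C n) := fun j => by
    have h : ∀ t : A.V ⊗[K] C.R, t ∈ Submodule.span K (⋃ n, pureTensors A.gr C n) := fun t => by
      induction t using DirectSum.Decomposition.inductionOn (tensorGr A.gr C) with
      | zero => exact Submodule.zero_mem _
      | add a b ha hb => exact Submodule.add_mem _ ha hb
      | @homogeneous n a => exact Submodule.span_mono (Set.subset_iUnion _ n) a.2
    exact h (x j)
  refine multilinear_eq_of_span
    ((φ.toAlg.toLinearMap.lTensor A.V).compMultilinearMap (tensorExt A.gr C n (A.act n μ)))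
    ((tensorExt A.gr D n (A.act n μ)).compLinearMap fun _ => φ.toAlg.toLinearMap.lTensor A.V)
    _ (fun x hx => ?_) x hx
  simp only [Set.mem_iUnion] at hx
  choose r p q a c hr ha hc hx using hx
  obtain rfl : x = fun j => a j ⊗ₜ c j := funext fun j => (hx j).symm
  simp only [LinearMap.compMultilinearMap_apply, MultilinearMap.compLinearMap_apply,
    tensorExt_tmul A.gr C _ p q a c ha hc, LinearMap.lTensor_tmul, map_smul]
  have := tensorExt_tmul A.gr D (A.act n μ) p q a (fun j => φ.toAlg (c j)) ha
    (fun j => φ.map_gr _ _ (hc j))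
  simp only [AlgHom.toLinearMap_apply]
  rw [this, map_list_prod, List.map_ofFn]
  rfl

theorem tensorMap_mem (A : PAlgebra P) {C D : GCAlg K} (φ : C ⟶ D) {n : ℕ} {x : A.V ⊗[K] C.R}
    (hx : x ∈ tensorGr A.gr C n) : φ.toAlg.toLinearMap.lTensor A.V x ∈ tensorGr A.gr D n := by
  induction hx using Submodule.span_induction with
  | mem x h =>
    obtain ⟨p, q, a, c, h, ha, hc, rfl⟩ := h
    exact tmul_mem_tensorGr A.gr D h ha (φ.map_gr q c hc)
  | zero => rw [map_zero]; exact Submodule.zero_mem _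
  | add x y _ _ hx hy => rw [map_add]; exact Submodule.add_mem _ hx hy
  | smul r x _ hx => rw [map_smul]; exact Submodule.smul_mem _ r hx

/-- The functor `A ⊗ -` from graded commutative algebras to `P`-algebras. -/
noncomputable def tensorFunctor (A : PAlgebra P) : GCAlg K ⥤ PAlgebra P where
  obj C := tensorObj A C
  map φ :=
    { toLin := φ.toAlg.toLinearMap.lTensor A.V
      map_gr := fun _ _ hx => tensorMap_mem A φ hx
      map_act := fun μ x => tensorMap_act A φ μ x }
  map_id C := PAlgebra.Hom.ext (LinearMap.lTensor_id A.V C.R)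
  map_comp φ ψ :=
    PAlgebra.Hom.ext (LinearMap.lTensor_comp A.V ψ.toAlg.toLinearMap φ.toAlg.toLinearMap)

end Tensor

/-! ### Graded algebras given by generators and relations -/

section Presented

variable {K : Type u} [Field K] {X : Type*} (deg : X → ℕ)

variable (K) in
/-- The elements of degree `n` of the free associative algebra on generators `x` of degrees `deg x`:
the span of the words of total degree `n`. -/
def freeGr (n : ℕ) : Submodule K (FreeAlgebra K X) :=
  Submodule.span K {y | ∃ L : List X, (L.map deg).sum = n ∧ (L.map (FreeAlgebra.ι K)).prod = y}

theorem ι_mem_freeGr (x : X) : FreeAlgebra.ι K x ∈ freeGr K deg (deg x) :=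
  Submodule.subset_span ⟨[x], by simp, by simp⟩

theorem one_mem_freeGr : (1 : FreeAlgebra K X) ∈ freeGr K deg 0 :=
  Submodule.subset_span ⟨[], by simp, by simp⟩

theorem mul_mem_freeGr {n n' : ℕ} {y y' : FreeAlgebra K X} (hy : y ∈ freeGr K deg n)
    (hy' : y' ∈ freeGr K deg n') : y * y' ∈ freeGr K deg (n + n') := by
  have h : freeGr K deg n * freeGr K deg n' ≤ freeGr K deg (n + n') := by
    unfold freeGr
    rw [Submodule.span_mul_span]
    refine Submodule.span_mono ?_
    rintro _ ⟨_, ⟨L, rfl, rfl⟩, _, ⟨L', rfl, rfl⟩, rfl⟩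
    exact ⟨L ++ L', by simp, by simp⟩
  exact h (Submodule.mul_mem_mul hy hy')

theorem list_prod_mem_freeGr {n : ℕ} (q : Fin n → ℕ) (c : Fin n → FreeAlgebra K X)
    (hc : ∀ j, c j ∈ freeGr K deg (q j)) : (List.ofFn c).prod ∈ freeGr K deg (∑ j, q j) := by
  induction n with
  | zero => simpa using one_mem_freeGr deg
  | succ n ih =>
    rw [List.ofFn_succ, List.prod_cons, Fin.sum_univ_succ]
    exact mul_mem_freeGr deg (hc 0) (ih _ _ fun j => hc j.succ)

variable (r : FreeAlgebra K X → FreeAlgebra K X → Prop)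

/-- The elements of degree `n` of the quotient of the free algebra by the relations `r`. -/
def quotGr (n : ℕ) : Submodule K (RingQuot r) :=
  (freeGr K deg n).map (RingQuot.mkAlgHom K r).toLinearMap

theorem mk_mem_quotGr {n : ℕ} {y : FreeAlgebra K X} (hy : y ∈ freeGr K deg n) :
    RingQuot.mkAlgHom K r y ∈ quotGr deg r n := ⟨y, hy, rfl⟩

instance quotGr_gradedMonoid : SetLike.GradedMonoid (quotGr deg r) where
  one_mem := ⟨1, one_mem_freeGr deg, map_one (RingQuot.mkAlgHom K r)⟩
  mul_mem := by
    rintro i j _ _ ⟨y, hy, rfl⟩ ⟨y', hy', rfl⟩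
    exact ⟨y * y', mul_mem_freeGr deg hy hy', map_mul (RingQuot.mkAlgHom K r) y y'⟩

/-- The decomposition into homogeneous components, on the free algebra. -/
noncomputable def freeDecompose : FreeAlgebra K X →ₐ[K] DirectSum ℕ fun n => quotGr deg r n :=
  FreeAlgebra.lift K fun x => DirectSum.of (fun n => quotGr deg r n) (deg x)
    ⟨RingQuot.mkAlgHom K r (FreeAlgebra.ι K x), mk_mem_quotGr deg r (ι_mem_freeGr deg x)⟩

theorem freeDecompose_of_mem {n : ℕ} {y : FreeAlgebra K X} (hy : y ∈ freeGr K deg n) :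
    freeDecompose deg r y = DirectSum.of (fun n => quotGr deg r n) n
      ⟨RingQuot.mkAlgHom K r y, mk_mem_quotGr deg r hy⟩ := by
  have hy' := hy
  unfold freeGr at hy'
  induction hy' using Submodule.span_induction with
  | mem x h =>
    obtain ⟨L, rfl, rfl⟩ := h
    induction L with
    | nil => simp; rfl
    | cons x L ih =>
      have h1 := ih (Submodule.subset_span ⟨L, rfl, rfl⟩)
      have h2 : freeDecompose deg r (FreeAlgebra.ι K x) = _ := FreeAlgebra.lift_ι_apply _ _
      simp only [List.map_cons, List.prod_cons, map_mul]
      rw [h1, h2, DirectSum.of_mul_of]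
      rfl
  | zero =>
    simp only [map_zero]
    exact (map_zero _).symm
  | add x y hx1 hy1 hx2 hy2 =>
    simp only [map_add]
    rw [hx2 hx1, hy2 hy1, ← map_add]
    rfl
  | smul a x hx1 hx2 =>
    simp only [map_smul]
    rw [hx2 hx1, ← DirectSum.lof_eq_of K, ← DirectSum.lof_eq_of K, ← map_smul]
    rfl

/-- If the relations are homogeneous, then the quotient is graded. -/
noncomputable abbrev quotGraded
    (hr : ∀ y z, r y z → ∃ n, y ∈ freeGr K deg n ∧ z ∈ freeGr K deg n) :
    GradedAlgebra (quotGr deg r) :=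
  GradedAlgebra.ofAlgHom (quotGr deg r)
    (RingQuot.liftAlgHom K ⟨freeDecompose deg r, fun y z h => by
      obtain ⟨n, hy, hz⟩ := hr y z h
      rw [freeDecompose_of_mem deg r hy, freeDecompose_of_mem deg r hz]
      congr 2
      exact RingQuot.mkAlgHom_rel K h⟩)
    (by
      ext x
      simp only [Function.comp_apply, RingQuot.liftAlgHom_mkAlgHom_apply,
        AlgHom.id_apply, AlgHom.coe_comp]
      rw [freeDecompose_of_mem deg r (ι_mem_freeGr deg x), DirectSum.coeAlgHom_of])
    (by
      rintro i ⟨_, y, hy, rfl⟩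
      exact (RingQuot.liftAlgHom_mkAlgHom_apply K _ _ y).trans (freeDecompose_of_mem deg r hy))

/-- If the generators commute up to the sign of their degrees, then the quotient is graded
commutative. -/
theorem quotGr_comm
    (hc : ∀ x x' : X, r (FreeAlgebra.ι K x * FreeAlgebra.ι K x')
      ((-1 : K) ^ (deg x * deg x') • (FreeAlgebra.ι K x' * FreeAlgebra.ι K x)))
    (p q : ℕ) (a b : RingQuot r) (ha : a ∈ quotGr deg r p) (hb : b ∈ quotGr deg r q) :
    a * b = (-1 : K) ^ (p * q) • (b * a) := by
  have h1 : ∀ x x' : X, RingQuot.mkAlgHom K r (FreeAlgebra.ι K x) *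
      RingQuot.mkAlgHom K r (FreeAlgebra.ι K x') = (-1 : K) ^ (deg x * deg x') •
      (RingQuot.mkAlgHom K r (FreeAlgebra.ι K x') * RingQuot.mkAlgHom K r (FreeAlgebra.ι K x)) :=
    fun x x' => by
      rw [← map_mul, RingQuot.mkAlgHom_rel K (hc x x'), map_smul, map_mul]
  set g : X → RingQuot r := fun x => RingQuot.mkAlgHom K r (FreeAlgebra.ι K x) with hg
  have h2 : ∀ (x : X) (L : List X), g x * (L.map g).prod =
      (-1 : K) ^ (deg x * (L.map deg).sum) • ((L.map g).prod * g x) := fun x L => by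
    induction L with
    | nil => simp
    | cons y L ih =>
      simp only [List.map_cons, List.prod_cons, List.sum_cons]
      rw [← mul_assoc, h1 x y, smul_mul_assoc, mul_assoc, ih, mul_smul_comm, smul_smul, ← pow_add,
        ← mul_add, mul_assoc]
  have h3 : ∀ L L' : List X, (L.map g).prod * (L'.map g).prod =
      (-1 : K) ^ ((L.map deg).sum * (L'.map deg).sum) • ((L'.map g).prod * (L.map g).prod) :=
    fun L L' => by
      induction L with
      | nil => simp
      | cons y L ih =>
        simp only [List.map_cons, List.prod_cons, List.sum_cons]
        rw [mul_assoc, ih, mul_smul_comm, ← mul_assoc, h2 y L', smul_mul_assoc, smul_smul,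
          ← pow_add, mul_assoc, add_mul, add_comm]
  have h4 : ∀ L : List X, RingQuot.mkAlgHom K r (L.map (FreeAlgebra.ι K)).prod = (L.map g).prod :=
    fun L => by rw [map_list_prod, List.map_map]; rfl
  obtain ⟨y, hy, rfl⟩ := ha
  obtain ⟨z, hz, rfl⟩ := hb
  simp only [AlgHom.toLinearMap_apply]
  unfold freeGr at hy hz
  induction hy using Submodule.span_induction with
  | mem y h =>
    obtain ⟨L, rfl, rfl⟩ := h
    induction hz using Submodule.span_induction with
    | mem z h =>
      obtain ⟨L', rfl, rfl⟩ := h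
      rw [h4, h4]
      exact h3 L L'
    | zero => simp
    | add x y _ _ hx hy => rw [map_add, mul_add, add_mul, smul_add, hx, hy]
    | smul a x _ hx => rw [map_smul, mul_smul_comm, smul_mul_assoc, hx, smul_comm]
  | zero => simp
  | add x y _ _ hx hy => rw [map_add, mul_add, add_mul, smul_add, hx, hy]
  | smul a x _ hx => rw [map_smul, mul_smul_comm, smul_mul_assoc, hx, smul_comm]

end Presented

/-! ### The universal graded algebra -/

section Universal

/-- The indices of the generators of the universal graded algebra, where `d p` is the dimension of
the component of degree `p`: the generator `x` with index `(deg₁, s, deg₂, i)` is the coefficient of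
the `s`-th basis vector of degree `deg₁` in the image of the `i`-th basis vector of degree `deg₂`. -/
structure Gen (d : ℕ → ℕ) : Type where
  deg₁ : ℕ
  s : Fin (d deg₁)
  deg₂ : ℕ
  i : Fin (d deg₂)
  le : deg₁ ≤ deg₂

/-- The cohomological degree of a generator. -/
def Gen.deg {d : ℕ → ℕ} (x : Gen d) : ℕ := x.deg₂ - x.deg₁

variable {K : Type u} [Field K] {P : GradedOperad.{u, w} K} (A : PAlgebra P) {d : ℕ → ℕ}
  (b : ∀ p, Module.Basis (Fin (d p)) K (A.gr p))

/-- The structure constants: the coefficient of the `s`-th basis vector of degree `e` in the value of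
the operation `μ` on the basis vectors of degrees `p j` and indices `i j`. -/
noncomputable def structConst {k : ℕ} (μ : P.obj k) (p : Fin k → ℕ) (i : ∀ j, Fin (d (p j)))
    (e : ℕ) (s : Fin (d e)) : K :=
  (b e).repr (DirectSum.decompose A.gr (A.act k μ fun j => (b (p j) (i j) : A.V)) e) s

/-- The universal graded polynomial of cohomological degree `θ - e`, where `θ` is the degree of the
value of `μ` on basis vectors of degrees `p j` and indices `i j`, and `a` is the index of a basis
vector of degree `e ≤ θ`. Here `m` is the degree of `μ`, the degrees `ε j ≤ p j` in the second sum
are subject to `∑ ε j + m = e`, and products of generators are taken in their natural order. -/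
noncomputable def universalPoly {k : ℕ} (m : ℤ) (μ : P.obj k) (p : Fin k → ℕ)
    (i : ∀ j, Fin (d (p j))) (θ e : ℕ) (he : e ≤ θ) (a : Fin (d e)) : FreeAlgebra K (Gen d) :=
  (∑ v : Fin (d θ), structConst A b μ p i θ v • FreeAlgebra.ι K (Gen.mk e a θ v he)) -
  ∑ ε : (∀ j, Fin (p j + 1)), if (∑ j, ((ε j : ℕ) : ℤ)) + m = e then
    ∑ s : (∀ j, Fin (d (ε j))),
      ((-1 : K) ^ crossSign (fun j => (ε j : ℕ)) (fun j => p j - ε j) *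
        structConst A b μ (fun j => (ε j : ℕ)) s e a) •
      (List.ofFn fun j => FreeAlgebra.ι K
        (Gen.mk (ε j) (s j) (p j) (i j) (Nat.lt_succ_iff.1 (ε j).2))).prod
  else 0

/-- The defining relations of the universal graded algebra in the free associative algebra on the
generators: graded commutativity, and the vanishing of the universal graded polynomials. -/
inductive UniversalRel : FreeAlgebra K (Gen d) → FreeAlgebra K (Gen d) → Prop
  | comm (x y : Gen d) : UniversalRel (FreeAlgebra.ι K x * FreeAlgebra.ι K y)
      ((-1 : K) ^ (x.deg * y.deg) • (FreeAlgebra.ι K y * FreeAlgebra.ι K x))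
  | poly {k : ℕ} (m : ℤ) (μ : P.obj k) (hμ : μ ∈ P.gr k m) (p : Fin k → ℕ)
      (i : ∀ j, Fin (d (p j))) (θ e : ℕ) (hθ : (θ : ℤ) = (∑ j, (p j : ℤ)) + m) (he : e ≤ θ)
      (a : Fin (d e)) : UniversalRel (universalPoly A b m μ p i θ e he a) 0

theorem universalPoly_mem {k : ℕ} (m : ℤ) (μ : P.obj k) (p : Fin k → ℕ)
    (i : ∀ j, Fin (d (p j))) (θ e : ℕ) (hθ : (θ : ℤ) = (∑ j, (p j : ℤ)) + m) (he : e ≤ θ)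
    (a : Fin (d e)) :
    universalPoly A b m μ p i θ e he a ∈ freeGr K Gen.deg (θ - e) := by
  refine Submodule.sub_mem _ (Submodule.sum_mem _ fun v _ => Submodule.smul_mem _ _ ?_)
    (Submodule.sum_mem _ fun ε _ => ?_)
  · exact ι_mem_freeGr Gen.deg (Gen.mk e a θ v he)
  · split_ifs with h
    · refine Submodule.sum_mem _ fun s _ => Submodule.smul_mem _ _ ?_
      have h1 := list_prod_mem_freeGr (K := K) Gen.deg (fun j => p j - ε j)
        (fun j => FreeAlgebra.ι K
          (Gen.mk (ε j) (s j) (p j) (i j) (Nat.lt_succ_iff.1 (ε j).2)))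
        (fun j => ι_mem_freeGr (K := K) Gen.deg
          (Gen.mk (ε j) (s j) (p j) (i j) (Nat.lt_succ_iff.1 (ε j).2)))
      have h2 : ∑ j, (p j - (ε j : ℕ)) = θ - e := by
        have h3 : ((∑ j, (p j - (ε j : ℕ)) : ℕ) : ℤ) = (∑ j, (p j : ℤ)) - ∑ j, ((ε j : ℕ) : ℤ) := by
          rw [← Finset.sum_sub_distrib]
          push_cast
          exact Finset.sum_congr rfl fun j _ => Nat.cast_sub (Nat.lt_succ_iff.1 (ε j).2)
        omega
      rwa [h2] at h1
    · exact Submodule.zero_mem _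

theorem universalRel_homogeneous (y z : FreeAlgebra K (Gen d)) (h : UniversalRel A b y z) :
    ∃ n, y ∈ freeGr K Gen.deg n ∧ z ∈ freeGr K Gen.deg n := by
  cases h with
  | comm x y =>
    have h1 := mul_mem_freeGr Gen.deg (ι_mem_freeGr (K := K) Gen.deg x)
      (ι_mem_freeGr (K := K) Gen.deg y)
    have h2 := mul_mem_freeGr Gen.deg (ι_mem_freeGr (K := K) Gen.deg y)
      (ι_mem_freeGr (K := K) Gen.deg x)
    rw [add_comm] at h2
    exact ⟨x.deg + y.deg, h1, Submodule.smul_mem _ _ h2⟩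
  | poly m μ hμ p i θ e hθ he a =>
    exact ⟨θ - e, universalPoly_mem A b m μ p i θ e hθ he a, Submodule.zero_mem _⟩

/-- The universal graded algebra of `A` with respect to the homogeneous basis `b`: the quotient of
the graded commutative polynomial algebra on the generators by the universal graded polynomials. -/
noncomputable def universalAlgebra : GCAlg K where
  R := RingQuot (UniversalRel A b)
  gr := quotGr Gen.deg (UniversalRel A b)
  graded := quotGraded Gen.deg (UniversalRel A b) (universalRel_homogeneous A b)
  comm := quotGr_comm Gen.deg (UniversalRel A b) UniversalRel.comm

/-- The class of a generator in the universal graded algebra. -/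
noncomputable def universalGen (x : Gen d) : (universalAlgebra A b).R :=
  RingQuot.mkAlgHom K (UniversalRel A b) (FreeAlgebra.ι K x)

end Universal

end GradedOperads

open GradedOperads

namespace GradedOperads

/-! Fix a homogeneous basis of `A` and one of a `P`-algebra `B`. Because `C` lives in nonnegative
degrees, a linear map `B → A ⊗ C` of degree `0` sends a basis vector of degree `p` to a combination
of basis vectors of `A` of degrees `ε ≤ p`, with coefficients in `C` of degree `p - ε`. If every
`A_ε` is finite-dimensional, only finitely many coefficients occur for each `p`, so they may be
prescribed freely: such maps are the same as matrices of homogeneous elements of `C`, and `C` enters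
only through the entries (`coeffMap`, `coeff`, `ofCoeff_coeff`).

For `B = A`, the map with matrix `c` commutes with a homogeneous operation on basis vectors exactly
when the corresponding universal polynomials vanish at `c`: they are the coefficients of the
difference of the two sides (`lift_universalPoly`). Hence morphisms `A ⟶ A ⊗ C` are the same as
algebra maps from the universal algebra to `C`, and the matrix of classes of generators gives the
universal morphism.

For general `B`, the corepresenting algebra has the matrix entries as generators, and as relations
all homogeneous equations satisfied by the entries of every morphism `B ⟶ A ⊗ C`, for all `C`. Every
morphism then factors by construction. The generic matrix is itself a morphism, since the equations
expressing this hold for every actual morphism and so are among the relations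
(`corepresentingAlgebra_property`). Universal arrows out of every `B` give the left adjoint.

Conversely, suppose a left adjoint exists. Let `J` be the underlying set of `A_p`, and let `B` be
the graded power `A^J`. The projections `B ⟶ A`, followed by `a ↦ a ⊗ 1`, correspond to morphisms
from the left adjoint at `B` to `K`. Together these form one morphism to `K^J`, hence one `F : B ⟶ A
⊗ K^J` with the given components. Apply `F` to the tautological family `(a)` indexed by `a ∈ A_p`.
The value is a finite sum of pure tensors, so all its components lie in one finite-dimensional
subspace of `A`; but these components are all the elements of `A_p`. -/

/-- A linear map is of degree `0` as soon as it is so on a homogeneous basis. -/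
theorem map_mem_of_basis {K : Type u} [Field K] {V : Type u} [AddCommGroup V] [Module K V]
    (gr : ℕ → Submodule K V) {I : ℕ → Type*} (b : ∀ p, Module.Basis (I p) K (gr p)) {W : Type*}
    [AddCommGroup W] [Module K W] (gr' : ℕ → Submodule K W) (L : V →ₗ[K] W)
    (h : ∀ p i, L (b p i) ∈ gr' p) (p : ℕ) (x : V) (hx : x ∈ gr p) : L x ∈ gr' p := by
  have h1 : ⟨x, hx⟩ ∈ Submodule.span K (Set.range (b p)) := by
    rw [(b p).span_eq]
    trivial
  have h2 : Submodule.span K (Set.range (b p)) ≤ ((gr' p).comap (L ∘ₗ (gr p).subtype)) := by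
    rw [Submodule.span_le]
    rintro _ ⟨i, rfl⟩
    exact h p i
  exact h2 h1

/-! ### Homogeneous elements of `V ⊗ C` built from coefficients -/

section OfCoeff

variable {K : Type u} [Field K] {V : Type u} [AddCommGroup V] [Module K V]
  (gr : ℕ → Submodule K V) (C : GCAlg K) {d : ℕ → ℕ} (b : ∀ p, Module.Basis (Fin (d p)) K (gr p))

/-- The element of `V ⊗ C` of degree `n` with given coefficients. -/
noncomputable def ofCoeff (n : ℕ) (c : ∀ ε, Fin (d ε) → ε ≤ n → C.R) : V ⊗[K] C.R :=
  ∑ ε : Fin (n + 1), ∑ s : Fin (d ε), (b ε s : V) ⊗ₜ[K] c ε s (Nat.lt_succ_iff.1 ε.2)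

theorem ofCoeff_mem (n : ℕ) (c : ∀ ε, Fin (d ε) → ε ≤ n → C.R)
    (hc : ∀ ε s h, c ε s h ∈ C.gr (n - ε)) : ofCoeff gr C b n c ∈ tensorGr gr C n :=
  Submodule.sum_mem _ fun ε _ => Submodule.sum_mem _ fun s _ =>
    tmul_mem_tensorGr gr C (Nat.add_sub_of_le (Nat.lt_succ_iff.1 ε.2)) (b ε s).2 (hc _ _ _)

theorem lTensor_ofCoeff {C D : GCAlg K} (φ : C.R →ₗ[K] D.R) (n : ℕ)
    (c : ∀ ε, Fin (d ε) → ε ≤ n → C.R) :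
    φ.lTensor V (ofCoeff gr C b n c) = ofCoeff gr D b n fun ε s h => φ (c ε s h) := by
  simp [ofCoeff]

end OfCoeff

/-! ### Coefficients with respect to a homogeneous basis -/

section HomogeneousBasis

variable {K : Type u} [Field K] {V : Type u} [AddCommGroup V] [Module K V]
  (gr : ℕ → Submodule K V) [DirectSum.Decomposition gr]

/-- The homogeneous basis of a graded vector space obtained from bases of its components. -/
noncomputable def homBasis {I : ℕ → Type*} (b : ∀ p, Module.Basis (I p) K (gr p)) :
    Module.Basis (Σ p, I p) K V :=
  (DirectSum.Decomposition.isInternal gr).collectedBasis b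

theorem homBasis_apply {I : ℕ → Type*} (b : ∀ p, Module.Basis (I p) K (gr p)) (x : Σ p, I p) :
    homBasis gr b x = b x.1 x.2 := by
  simp [homBasis]

theorem decompose_eq_zero {p e : ℕ} {x : V} (hx : x ∈ gr p) (h : p ≠ e) :
    DirectSum.decompose gr x e = 0 :=
  Subtype.ext (DirectSum.decompose_of_mem_ne gr hx h)

/-- A coordinate indexed in degree `e` sees only the component of degree `e`. Structure constants
are defined through components, and this identifies them with coordinates in the homogeneous basis.
-/
theorem homBasis_repr {I : ℕ → Type*} (b : ∀ p, Module.Basis (I p) K (gr p)) (y : V) (e : ℕ)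
    (a : I e) :
    (homBasis gr b).repr y ⟨e, a⟩ = (b e).repr (DirectSum.decompose gr y e) a := by
  induction y using DirectSum.Decomposition.inductionOn gr with
  | zero => simp
  | add y z hy hz => simp [hy, hz]
  | @homogeneous p y =>
    by_cases h : p = e
    · subst h
      rw [homBasis, DirectSum.IsInternal.collectedBasis_repr_of_mem _ _ y.2]
      simp
    · rw [homBasis, DirectSum.IsInternal.collectedBasis_repr_of_mem_ne _ _ h y.2,
        decompose_eq_zero gr y.2 h]
      simp

variable (C : GCAlg K)

/-- The coefficients of the elements of `V ⊗ C` with respect to a homogeneous basis of `V`. -/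
noncomputable def coeff {I : ℕ → Type*} (b : ∀ p, Module.Basis (I p) K (gr p)) :
    V ⊗[K] C.R ≃ₗ[K] (Σ p, I p) →₀ C.R :=
  letI := Classical.decEq (Σ p, I p)
  TensorProduct.equivFinsuppOfBasisLeft (homBasis gr b)

theorem coeff_tmul {I : ℕ → Type*} (b : ∀ p, Module.Basis (I p) K (gr p)) (v : V) (c : C.R)
    (e : ℕ) (a : I e) :
    coeff gr C b (v ⊗ₜ c) ⟨e, a⟩ = (b e).repr (DirectSum.decompose gr v e) a • c := by
  let _ := Classical.decEq (Σ p, I p)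
  exact (TensorProduct.equivFinsuppOfBasisLeft_apply_tmul_apply (homBasis gr b) v c ⟨e, a⟩).trans
    (by rw [homBasis_repr])

/-- A pure tensor of degrees `(p, q)` contributes at `e` only if `p = e`, and then `q = n - e`. The
bases here may be infinite: extracting coefficients needs no finiteness, whereas prescribing them
through `ofCoeff` does. -/
theorem coeff_mem {I : ℕ → Type*} (b : ∀ p, Module.Basis (I p) K (gr p)) {n : ℕ}
    {t : V ⊗[K] C.R} (ht : t ∈ tensorGr gr C n) (e : ℕ) (he : e ≤ n) (a : I e) :
    coeff gr C b t ⟨e, a⟩ ∈ C.gr (n - e) := by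
  induction ht using Submodule.span_induction with
  | mem x h =>
    obtain ⟨p, q, v, c, rfl, hv, hc, rfl⟩ := h
    rw [coeff_tmul]
    by_cases h : p = e
    · subst h
      rw [Nat.add_sub_cancel_left]
      exact Submodule.smul_mem _ _ hc
    · rw [decompose_eq_zero gr hv h]
      simp
  | zero => simp
  | add x y _ _ hx hy => simpa using Submodule.add_mem _ hx hy
  | smul r x _ hx => simpa using Submodule.smul_mem _ r hx

/-- `C` has no negative degrees, so the `V`-factor of a tensor of total degree `n` has degree at
most `n`. -/
theorem coeff_eq_zero {I : ℕ → Type*} (b : ∀ p, Module.Basis (I p) K (gr p)) {n : ℕ}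
    {t : V ⊗[K] C.R} (ht : t ∈ tensorGr gr C n) (e : ℕ) (he : n < e) (a : I e) :
    coeff gr C b t ⟨e, a⟩ = 0 := by
  induction ht using Submodule.span_induction with
  | mem x h =>
    obtain ⟨p, q, v, c, rfl, hv, hc, rfl⟩ := h
    have h : p ≠ e := by omega
    rw [coeff_tmul, decompose_eq_zero gr hv h]
    simp
  | zero => simp
  | add x y _ _ hx hy => simp [hx, hy]
  | smul r x _ hx => simp [hx]

/-- Naturality in `C`: a change of `C` acts on the coefficients alone. This transports equations
between coefficients along morphisms. -/
theorem coeff_lTensor {I : ℕ → Type*} (b : ∀ p, Module.Basis (I p) K (gr p)) {C D : GCAlg K}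
    (φ : C.R →ₗ[K] D.R) (t : V ⊗[K] C.R) (x : Σ p, I p) :
    coeff gr D b (φ.lTensor V t) x = φ (coeff gr C b t x) := by
  obtain ⟨e, a⟩ := x
  induction t using TensorProduct.induction_on with
  | zero => simp
  | tmul v c => simp [coeff_tmul]
  | add s t hs ht => simp [hs, ht]

variable {d : ℕ → ℕ} (b : ∀ p, Module.Basis (Fin (d p)) K (gr p))

theorem coeff_basis_tmul (p : ℕ) (s : Fin (d p)) (c : C.R) (e : ℕ) (a : Fin (d e)) :
    coeff gr C b ((b p s : V) ⊗ₜ c) ⟨e, a⟩ =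
      if (⟨p, s⟩ : Σ p, Fin (d p)) = ⟨e, a⟩ then c else 0 := by
  rw [coeff_tmul, ← homBasis_repr, ← homBasis_apply gr b ⟨p, s⟩, Module.Basis.repr_self,
    Finsupp.single_apply]
  simp

theorem coeff_ofCoeff (n : ℕ) (c : ∀ ε, Fin (d ε) → ε ≤ n → C.R) (e : ℕ) (a : Fin (d e)) :
    coeff gr C b (ofCoeff gr C b n c) ⟨e, a⟩ = if h : e ≤ n then c e a h else 0 := by
  simp only [ofCoeff, map_sum, Finsupp.finsetSum_apply, coeff_basis_tmul]
  split_ifs with h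
  · rw [Finset.sum_eq_single ⟨e, Nat.lt_succ_iff.2 h⟩, Finset.sum_eq_single a]
    · simp
    · intro s _ hs
      simp [hs]
    · simp
    · intro ε _ hε
      refine Finset.sum_eq_zero fun s _ => if_neg fun h => hε ?_
      exact Fin.ext (congrArg Sigma.fst h)
    · simp
  · refine Finset.sum_eq_zero fun ε _ => Finset.sum_eq_zero fun s _ => if_neg fun h' => h ?_
    have : (ε : ℕ) = e := congrArg Sigma.fst h'
    exact this ▸ Nat.lt_succ_iff.1 ε.2

/-- The finite sum stops at degree `n`, but no coefficient is lost, since those beyond `n` vanish.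
With `coeff_ofCoeff` this makes homogeneous elements and families of coefficients equivalent data.
-/
theorem ofCoeff_coeff {n : ℕ} {t : V ⊗[K] C.R} (ht : t ∈ tensorGr gr C n) :
    ofCoeff gr C b n (fun ε s _ => coeff gr C b t ⟨ε, s⟩) = t := by
  refine (coeff gr C b).injective (Finsupp.ext fun ⟨e, a⟩ => ?_)
  rw [coeff_ofCoeff]
  split_ifs with h
  · rfl
  · exact (coeff_eq_zero gr C b ht e (not_le.1 h) a).symm

end HomogeneousBasis

/-! ### Morphisms to `A ⊗ C` as matrices of coefficients -/

section Morphisms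

variable {K : Type u} [Field K] {P : GradedOperad.{u, w} K}

/-- A linear map between `P`-algebras commutes with the operations as soon as it does so with the
homogeneous operations on homogeneous basis vectors. -/
theorem map_act_of_basis {A B : PAlgebra P} {I : ℕ → Type*}
    (b : ∀ p, Module.Basis (I p) K (A.gr p)) (L : A.V →ₗ[K] B.V)
    (h : ∀ {n : ℕ} (m : ℤ) (μ : P.obj n), μ ∈ P.gr n m → ∀ (p : Fin n → ℕ) (i : ∀ j, I (p j)),
      L (A.act n μ fun j => b (p j) (i j)) = B.act n μ fun j => L (b (p j) (i j)))
    {n : ℕ} (μ : P.obj n) (x : Fin n → A.V) :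
    L (A.act n μ x) = B.act n μ fun j => L (x j) := by
  -- Both sides are linear in `μ` and multilinear in `x`, so homogeneous operations and basis
  -- vectors suffice.
  have hμ : μ ∈ ⨆ m, P.gr n m := by
    rw [(P.isInternal n).submodule_iSup_eq_top]
    trivial
  induction hμ using Submodule.iSup_induction' with
  | mem m μ hμ =>
    refine multilinear_eq_of_span (L.compMultilinearMap (A.act n μ))
      ((B.act n μ).compLinearMap fun _ => L) (fun _ => Set.range (homBasis A.gr b))
      (fun x hx => ?_) x fun j => by
        rw [(homBasis A.gr b).span_eq]
        trivial
    choose s hs using hx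
    obtain rfl : x = fun j => (b (s j).1 (s j).2 : A.V) :=
      funext fun j => by rw [← hs j, homBasis_apply]
    exact h m μ hμ (fun j => (s j).1) fun j => (s j).2
  | zero => simp
  | add μ ν _ _ hμ hν => simp [hμ, hν]

variable {A B : PAlgebra P} {I : ℕ → Type*} (β : ∀ p, Module.Basis (I p) K (B.gr p))
  {d : ℕ → ℕ} (b : ∀ p, Module.Basis (Fin (d p)) K (A.gr p))

/-- The linear map `B → A ⊗ C` with coefficients `c ε s p i` on homogeneous basis vectors. -/
noncomputable def coeffMap (C : GCAlg K) (c : ∀ ε, Fin (d ε) → ∀ p, I p → ε ≤ p → C.R) :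
    B.V →ₗ[K] A.V ⊗[K] C.R :=
  (homBasis B.gr β).constr K fun x => ofCoeff A.gr C b x.1 fun ε s h => c ε s x.1 x.2 h

theorem coeffMap_apply (C : GCAlg K) (c : ∀ ε, Fin (d ε) → ∀ p, I p → ε ≤ p → C.R) (p : ℕ)
    (i : I p) : coeffMap β b C c (β p i) = ofCoeff A.gr C b p fun ε s h => c ε s p i h := by
  rw [← homBasis_apply B.gr β ⟨p, i⟩, coeffMap, Module.Basis.constr_basis]

/-- A graded commutative algebra `U` generated by elements `x ε s p i`, through which all families
of coefficients of morphisms `B ⟶ A ⊗ C` factor, corepresents these morphisms if the linear map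
with coefficients `x` commutes with the operations. -/
theorem exists_universal (U : GCAlg K) (x : ∀ ε, Fin (d ε) → ∀ p, I p → ε ≤ p → U.R)
    (hx : ∀ ε s p i h, x ε s p i h ∈ U.gr (p - ε))
    (hext : ∀ (C : GCAlg K) (Φ Ψ : U ⟶ C),
      (∀ ε s p i h, Φ.toAlg (x ε s p i h) = Ψ.toAlg (x ε s p i h)) → Φ = Ψ)
    (hact : ∀ {n : ℕ} (m : ℤ) (μ : P.obj n), μ ∈ P.gr n m → ∀ (p : Fin n → ℕ) (i : ∀ j, I (p j)),
      coeffMap β b U x (B.act n μ fun j => β (p j) (i j)) =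
        (tensorObj A U).act n μ fun j => coeffMap β b U x (β (p j) (i j)))
    (hlift : ∀ (C : GCAlg K) (f : B ⟶ (tensorFunctor A).obj C), ∃ Φ : U ⟶ C, ∀ ε s p i h,
      Φ.toAlg (x ε s p i h) = coeff A.gr C b (f.toLin (β p i)) ⟨ε, s⟩) :
    ∃ η : B ⟶ (tensorFunctor A).obj U,
      (∀ p i, η.toLin (β p i) = ofCoeff A.gr U b p fun ε s h => x ε s p i h) ∧
      ∀ (C : GCAlg K) (f : B ⟶ (tensorFunctor A).obj C),
        ∃! Φ : U ⟶ C, f = η ≫ (tensorFunctor A).map Φ := by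
  let η : B ⟶ (tensorFunctor A).obj U :=
    { toLin := coeffMap β b U x
      map_gr := map_mem_of_basis B.gr β (tensorGr A.gr U) (coeffMap β b U x) fun p i => by
        rw [coeffMap_apply]
        exact ofCoeff_mem A.gr U b p _ fun ε s h => hx ε s p i h
      map_act := map_act_of_basis (B := tensorObj A U) β (coeffMap β b U x) hact }
  have hη : ∀ p i, η.toLin (β p i) = ofCoeff A.gr U b p fun ε s h => x ε s p i h :=
    coeffMap_apply β b U x
  have hcomp : ∀ (C : GCAlg K) (Φ : U ⟶ C) (p : ℕ) (i : I p),
      (η ≫ (tensorFunctor A).map Φ).toLin (β p i) =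
        ofCoeff A.gr C b p fun ε s h => Φ.toAlg (x ε s p i h) := fun C Φ p i => by
    have : (η ≫ (tensorFunctor A).map Φ).toLin (β p i) =
      Φ.toAlg.toLinearMap.lTensor A.V (η.toLin (β p i)) := rfl
    rw [this, hη, lTensor_ofCoeff]
    rfl
  refine ⟨η, hη, fun C f => ?_⟩
  obtain ⟨Φ, hΦ⟩ := hlift C f
  refine ⟨Φ, PAlgebra.Hom.ext ((homBasis B.gr β).ext fun ⟨p, i⟩ => ?_), fun Ψ hΨ => ?_⟩
  · rw [homBasis_apply, hcomp]
    simp only [hΦ]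
    exact (ofCoeff_coeff A.gr C b (f.map_gr p _ (β p i).2)).symm
  -- Any factorization `Ψ` is forced on the generators: its values there are the coefficients of
  -- `f`.
  · refine hext C Ψ Φ fun ε s p i h => ?_
    rw [hΦ, hΨ, hcomp, coeff_ofCoeff, dif_pos h]

end Morphisms

/-! ### Morphisms out of presented graded algebras -/

section PresentedLift

variable {K : Type u} [Field K] {X : Type*} (deg : X → ℕ)

theorem lift_mem_of_mem_freeGr (C : GCAlg K) (g : X → C.R) (hg : ∀ x, g x ∈ C.gr (deg x)) {n : ℕ}
    {y : FreeAlgebra K X} (hy : y ∈ freeGr K deg n) : FreeAlgebra.lift K g y ∈ C.gr n := by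
  unfold freeGr at hy
  induction hy using Submodule.span_induction with
  | mem y h =>
    obtain ⟨L, rfl, rfl⟩ := h
    induction L with
    | nil => simpa using SetLike.GradedOne.one_mem (A := C.gr)
    | cons x L ih =>
      simp only [List.map_cons, List.prod_cons, List.sum_cons, map_mul, FreeAlgebra.lift_ι_apply]
      exact SetLike.GradedMul.mul_mem (hg x) ih
  | zero => simp
  | add y z _ _ hy hz => rw [map_add]; exact Submodule.add_mem _ hy hz
  | smul r y _ hy => rw [map_smul]; exact Submodule.smul_mem _ r hy

/-- The grading of the quotient is the image of the grading of the free algebra by words, so the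
induced map has degree `0` as soon as the generators go to elements of the right degrees. -/
theorem exists_lift_of_rel (r : FreeAlgebra K X → FreeAlgebra K X → Prop) (C : GCAlg K)
    (g : X → C.R) (hg : ∀ x, g x ∈ C.gr (deg x))
    (hr : ∀ y z, r y z → FreeAlgebra.lift K g y = FreeAlgebra.lift K g z) :
    ∃ Φ : RingQuot r →ₐ[K] C.R,
      (∀ y, Φ (RingQuot.mkAlgHom K r y) = FreeAlgebra.lift K g y) ∧
      ∀ n, ∀ y ∈ quotGr deg r n, Φ y ∈ C.gr n := by
  refine ⟨RingQuot.liftAlgHom K ⟨FreeAlgebra.lift K g, fun y z h => hr y z h⟩,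
    fun y => RingQuot.liftAlgHom_mkAlgHom_apply K _ _ y, ?_⟩
  rintro n _ ⟨y, hy, rfl⟩
  rw [AlgHom.toLinearMap_apply, RingQuot.liftAlgHom_mkAlgHom_apply]
  exact lift_mem_of_mem_freeGr deg C g hg hy

theorem ringQuot_algHom_ext {r : FreeAlgebra K X → FreeAlgebra K X → Prop} {R : Type*} [Ring R]
    [Algebra K R] {Φ Ψ : RingQuot r →ₐ[K] R}
    (h : ∀ x, Φ (RingQuot.mkAlgHom K r (FreeAlgebra.ι K x)) =
      Ψ (RingQuot.mkAlgHom K r (FreeAlgebra.ι K x))) : Φ = Ψ :=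
  RingQuot.ringQuot_ext' K Φ Ψ (FreeAlgebra.hom_ext (funext h))

theorem lift_comm_rel (C : GCAlg K) (g : X → C.R) (hg : ∀ x, g x ∈ C.gr (deg x)) (x y : X) :
    FreeAlgebra.lift K g (FreeAlgebra.ι K x * FreeAlgebra.ι K y) =
      FreeAlgebra.lift K g
        ((-1 : K) ^ (deg x * deg y) • (FreeAlgebra.ι K y * FreeAlgebra.ι K x)) := by
  simp only [map_mul, map_smul, FreeAlgebra.lift_ι_apply]
  exact C.comm _ _ _ _ (hg x) (hg y)

end PresentedLift

/-! ### Comparison of values in integral degrees -/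

section GradedValues

variable {K : Type u} [Field K] {P : GradedOperad.{u, w} K} (A : PAlgebra P)

/-- Two elements of the same integral degree of `A ⊗ C` agree if their coefficients at basis vectors
of at most this degree agree. -/
theorem eq_of_coeff_eq {I : ℕ → Type*} (b : ∀ p, Module.Basis (I p) K (A.gr p)) (C : GCAlg K)
    {z : ℤ} {t t' : A.V ⊗[K] C.R} (ht : t ∈ grZ (tensorGr A.gr C) z)
    (ht' : t' ∈ grZ (tensorGr A.gr C) z)
    (h : ∀ θ : ℕ, (θ : ℤ) = z → ∀ e ≤ θ, ∀ a,
      coeff A.gr C b t ⟨e, a⟩ = coeff A.gr C b t' ⟨e, a⟩) : t = t' := by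
  -- In a negative degree the component is zero. This is why relations are needed only for `θ ≥ 0`,
  -- and in degree `θ` only for `e ≤ θ`.
  rcases z with θ | θ
  · refine (coeff A.gr C b).injective (Finsupp.ext fun ⟨e, a⟩ => ?_)
    by_cases he : e ≤ θ
    · exact h θ rfl e he a
    · rw [coeff_eq_zero A.gr C b ht e (not_le.1 he), coeff_eq_zero A.gr C b ht' e (not_le.1 he)]
  · have h1 : t = 0 := ht
    have h2 : t' = 0 := ht'
    rw [h1, h2]

theorem map_mem_grZ {V W : Type*} [AddCommGroup V] [Module K V] [AddCommGroup W] [Module K W]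
    {gr : ℕ → Submodule K V} {gr' : ℕ → Submodule K W} (L : V →ₗ[K] W)
    (hL : ∀ p, ∀ x ∈ gr p, L x ∈ gr' p) {z : ℤ} {x : V} (hx : x ∈ grZ gr z) :
    L x ∈ grZ gr' z := by
  rcases z with p | p
  · exact hL p x hx
  · have h : x = 0 := hx
    rw [h, map_zero]
    exact Submodule.zero_mem _

end GradedValues

/-! ### The universal property of the universal graded algebra -/

section UniversalProperty

variable {K : Type u} [Field K] {P : GradedOperad.{u, w} K} (A : PAlgebra P) {d : ℕ → ℕ}
  (b : ∀ p, Module.Basis (Fin (d p)) K (A.gr p))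

/-- The universal graded polynomials measure the failure of a linear map `A → A ⊗ C` to commute with
the operations. -/
theorem lift_universalPoly (C : GCAlg K) (c : ∀ ε, Fin (d ε) → ∀ p, Fin (d p) → ε ≤ p → C.R)
    (hc : ∀ ε s p i h, c ε s p i h ∈ C.gr (p - ε)) {k : ℕ} (m : ℤ) (μ : P.obj k)
    (hμ : μ ∈ P.gr k m) (p : Fin k → ℕ) (i : ∀ j, Fin (d (p j))) (θ e : ℕ)
    (hθ : (θ : ℤ) = (∑ j, (p j : ℤ)) + m) (he : e ≤ θ) (a : Fin (d e)) :
    FreeAlgebra.lift K (fun x : Gen d => c x.deg₁ x.s x.deg₂ x.i x.le)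
        (universalPoly A b m μ p i θ e he a) =
      coeff A.gr C b (coeffMap b b C c (A.act k μ fun j => b (p j) (i j))) ⟨e, a⟩ -
        coeff A.gr C b ((tensorObj A C).act k μ fun j => coeffMap b b C c (b (p j) (i j)))
          ⟨e, a⟩ := by
  rw [universalPoly, map_sub]
  congr 1
  -- The first sum: expand the value of `μ` in the basis of `A_θ` by structure constants, then apply
  -- the map to each basis vector.
  · have hmem : A.act k μ (fun j => (b (p j) (i j) : A.V)) ∈ A.gr θ := by
      have := A.act_mem m μ p _ hμ fun j => (b (p j) (i j)).2
      rwa [grZ_natCast A.gr hθ.symm] at this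
    have hsum : A.act k μ (fun j => (b (p j) (i j) : A.V)) =
        ∑ v : Fin (d θ), structConst A b μ p i θ v • (b θ v : A.V) := by
      have := congrArg (Subtype.val) ((b θ).sum_repr ⟨_, hmem⟩)
      simp only [structConst, DirectSum.decompose_of_mem A.gr hmem, DirectSum.of_eq_same]
      refine this.symm.trans ?_
      simp only [Submodule.coe_sum, Submodule.coe_smul]
    rw [hsum]
    simp only [map_sum, map_smul, FreeAlgebra.lift_ι_apply, coeffMap_apply,
      Finsupp.finsetSum_apply, Finsupp.smul_apply, coeff_ofCoeff, he, dif_pos]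
  -- The second sum: expand the operation of `A ⊗ C` multilinearly over all degrees `ε j ≤ p j` and
  -- all basis vectors. The Koszul sign of the action is the sign in the polynomial.
  · have hact : ((tensorObj A C).act k μ fun j => coeffMap b b C c (b (p j) (i j))) =
        ∑ ε : (∀ j, Fin (p j + 1)), ∑ s : (∀ j, Fin (d (ε j))),
          (-1 : K) ^ crossSign (fun j => (ε j : ℕ)) (fun j => p j - ε j) •
            (A.act k μ (fun j => (b (ε j) (s j) : A.V)) ⊗ₜ[K] (List.ofFn fun j =>
              c (ε j) (s j) (p j) (i j) (Nat.lt_succ_iff.1 (ε j).2)).prod) := by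
      simp only [coeffMap_apply, ofCoeff]
      refine (MultilinearMap.map_sum ((tensorObj A C).act k μ) _).trans
        (Finset.sum_congr rfl fun ε _ => ?_)
      refine (MultilinearMap.map_sum ((tensorObj A C).act k μ) _).trans
        (Finset.sum_congr rfl fun s _ => ?_)
      exact tensorObj_act_tmul A C μ _ _ _ _ (fun j => (b (ε j) (s j)).2) fun j => hc _ _ _ _ _
    rw [hact]
    simp only [map_sum, map_smul, Finsupp.finsetSum_apply, Finsupp.smul_apply, coeff_tmul]
    refine Finset.sum_congr rfl fun ε _ => ?_
    split_ifs with h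
    · simp only [map_sum, map_smul, map_list_prod, List.map_ofFn, Function.comp_def,
        FreeAlgebra.lift_ι_apply, mul_smul, structConst]
    -- The terms omitted from the polynomial: here `μ` takes a value of degree `∑ ε j + m ≠ e`,
    -- which has no component in degree `e`.
    · rw [map_zero]
      refine (Finset.sum_eq_zero fun s _ => ?_).symm
      have hmem := A.act_mem m μ (fun j => (ε j : ℕ)) _ hμ fun j => (b (ε j) (s j)).2
      have h0 : DirectSum.decompose A.gr
          (A.act k μ fun j => (b (ε j) (s j) : A.V)) e = 0 := by
        rcases hz : (∑ j, ((ε j : ℕ) : ℤ)) + m with z | z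
        · rw [hz] at hmem
          refine decompose_eq_zero A.gr (p := z) hmem fun hze => h ?_
          rw [hz, ← hze]
          rfl
        · rw [hz] at hmem
          have h1 : A.act k μ (fun j => (b (ε j) (s j) : A.V)) = 0 := hmem
          rw [h1]
          simp
      rw [h0]
      simp

theorem coeffMap_gr {B : PAlgebra P} {I : ℕ → Type*} (β : ∀ p, Module.Basis (I p) K (B.gr p))
    (C : GCAlg K) (c : ∀ ε, Fin (d ε) → ∀ p, I p → ε ≤ p → C.R)
    (hc : ∀ ε s p i h, c ε s p i h ∈ C.gr (p - ε)) (p : ℕ) (x : B.V) (hx : x ∈ B.gr p) :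
    coeffMap β b C c x ∈ tensorGr A.gr C p :=
  map_mem_of_basis B.gr β (tensorGr A.gr C) (coeffMap β b C c) (fun p i => by
    rw [coeffMap_apply]
    exact ofCoeff_mem A.gr C b p _ fun ε s h => hc ε s p i h) p x hx

/-- By `lift_universalPoly`, a matrix with entries of the right degrees defines a morphism exactly
when the universal polynomials vanish at it. The generic matrix satisfies this in the quotient, and
the matrix of any `f` does so in `C`. -/
theorem universalAlgebra_property :
    ∃ η : A ⟶ (tensorFunctor A).obj (universalAlgebra A b),
      (∀ (p : ℕ) (i : Fin (d p)), η.toLin (b p i) = ofCoeff A.gr (universalAlgebra A b) b p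
        fun ε s h => universalGen A b (Gen.mk ε s p i h)) ∧
      ∀ (C : GCAlg K) (f : A ⟶ (tensorFunctor A).obj C),
        ∃! Φ : universalAlgebra A b ⟶ C, f = η ≫ (tensorFunctor A).map Φ := by
  have hx : ∀ ε s p i h, universalGen A b (Gen.mk ε s p i h) ∈
      (universalAlgebra A b).gr (p - ε) := fun ε s p i h =>
    mk_mem_quotGr Gen.deg (UniversalRel A b) (ι_mem_freeGr Gen.deg (Gen.mk ε s p i h))
  refine exists_universal b b (universalAlgebra A b)
    (fun ε s p i h => universalGen A b (Gen.mk ε s p i h)) hx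
    (fun C Φ Ψ h => GCAlg.Hom.ext (ringQuot_algHom_ext fun x => h x.deg₁ x.s x.deg₂ x.i x.le))
    (fun {n} m μ hμ p i => ?_) (fun C f => ?_)
  · refine eq_of_coeff_eq A b (universalAlgebra A b)
      (map_mem_grZ _ (coeffMap_gr A b b _ _ hx) (A.act_mem m μ p _ hμ fun j => (b _ _).2))
      ((tensorObj A (universalAlgebra A b)).act_mem m μ p _ hμ fun j =>
        coeffMap_gr A b b _ _ hx _ _ (b _ _).2) fun θ hθ e he a => sub_eq_zero.1 ?_
    rw [← lift_universalPoly A b _ _ hx m μ hμ p i θ e hθ he a]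
    -- Evaluation at the classes of the generators is the quotient map, so the difference of the two
    -- coefficients is the class of a defining relation.
    have h1 : FreeAlgebra.lift K (fun x : Gen d => universalGen A b x) =
        RingQuot.mkAlgHom K (UniversalRel A b) :=
      FreeAlgebra.hom_ext (funext fun x => FreeAlgebra.lift_ι_apply _ _)
    exact (DFunLike.congr_fun h1 _).trans
      ((RingQuot.mkAlgHom_rel K (UniversalRel.poly m μ hμ p i θ e hθ he a)).trans (map_zero _))
  · have hf : ∀ p i, f.toLin (b p i) ∈ tensorGr A.gr C p := fun p i => f.map_gr p _ (b p i).2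
    let c : ∀ ε, Fin (d ε) → ∀ p, Fin (d p) → ε ≤ p → C.R :=
      fun ε s p i _ => coeff A.gr C b (f.toLin (b p i)) ⟨ε, s⟩
    have hc : ∀ ε s p i h, c ε s p i h ∈ C.gr (p - ε) := fun ε s p i h =>
      coeff_mem A.gr C b (hf p i) ε h s
    -- `f` is the map with matrix `c`, so compatibility of `f` with the operations says that the
    -- universal polynomials vanish at `c`.
    have hL : coeffMap b b C c = f.toLin := (homBasis A.gr b).ext fun ⟨p, i⟩ => by
      rw [homBasis_apply, coeffMap_apply]
      exact ofCoeff_coeff A.gr C b (hf p i)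
    have hact : ∀ {n : ℕ} (μ : P.obj n) (x : Fin n → A.V), coeffMap b b C c (A.act n μ x) =
        (tensorObj A C).act n μ fun j => coeffMap b b C c (x j) := by
      rw [hL]
      exact f.map_act
    have hcg : ∀ x : Gen d, c x.deg₁ x.s x.deg₂ x.i x.le ∈ C.gr x.deg := fun x =>
      hc x.deg₁ x.s x.deg₂ x.i x.le
    obtain ⟨Φ, hΦ, hgr⟩ := exists_lift_of_rel Gen.deg (UniversalRel A b) C
      (fun x : Gen d => c x.deg₁ x.s x.deg₂ x.i x.le) hcg (fun y z h => by
        cases h with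
        | comm x y => exact lift_comm_rel Gen.deg C _ hcg x y
        | poly m μ hμ p i θ e hθ he a =>
          rw [lift_universalPoly A b C c hc m μ hμ p i θ e hθ he a, hact, map_zero]
          exact sub_self _)
    exact ⟨⟨Φ, hgr⟩, fun ε s p i h => (hΦ _).trans (FreeAlgebra.lift_ι_apply _ _)⟩

end UniversalProperty

/-! ### Corepresenting morphisms `B ⟶ A ⊗ C`, and the left adjoint -/

section Corepresenting

variable {K : Type u} [Field K] {P : GradedOperad.{u, w} K} {A B : PAlgebra P}

/-- The indices of the coefficients of morphisms `B ⟶ A ⊗ C` with respect to homogeneous bases. -/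
structure PairGen (d : ℕ → ℕ) (I : ℕ → Type u) : Type u where
  deg₁ : ℕ
  s : Fin (d deg₁)
  deg₂ : ℕ
  i : I deg₂
  le : deg₁ ≤ deg₂

/-- The degree of a coefficient. -/
def PairGen.deg {d : ℕ → ℕ} {I : ℕ → Type u} (x : PairGen d I) : ℕ := x.deg₂ - x.deg₁

variable {I : ℕ → Type u} (β : ∀ p, Module.Basis (I p) K (B.gr p))
  {d : ℕ → ℕ} (b : ∀ p, Module.Basis (Fin (d p)) K (A.gr p))

/-- The coefficients of a morphism `B ⟶ A ⊗ C`. -/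
noncomputable def homCoeff (C : GCAlg K) (f : B ⟶ (tensorFunctor A).obj C) (x : PairGen d I) :
    C.R :=
  coeff A.gr C b (f.toLin (β x.deg₂ x.i)) ⟨x.deg₁, x.s⟩

theorem homCoeff_mem (C : GCAlg K) (f : B ⟶ (tensorFunctor A).obj C) (x : PairGen d I) :
    homCoeff β b C f x ∈ C.gr x.deg :=
  coeff_mem A.gr C b (f.map_gr x.deg₂ _ (β x.deg₂ x.i).2) x.deg₁ x.le x.s

/-- The homogeneous relations satisfied by the coefficients of all morphisms `B ⟶ A ⊗ C`. -/
def HomRel (y z : FreeAlgebra K (PairGen d I)) : Prop :=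
  (∃ n, y ∈ freeGr K PairGen.deg n ∧ z ∈ freeGr K PairGen.deg n) ∧
    ∀ (C : GCAlg K) (f : B ⟶ (tensorFunctor A).obj C),
      FreeAlgebra.lift K (homCoeff β b C f) y = FreeAlgebra.lift K (homCoeff β b C f) z

/-- The sign rule holds in every `C`, hence is among the relations. It makes the quotient graded
commutative. -/
theorem homRel_comm (x y : PairGen d I) :
    HomRel β b (FreeAlgebra.ι K x * FreeAlgebra.ι K y)
      ((-1 : K) ^ (x.deg * y.deg) • (FreeAlgebra.ι K y * FreeAlgebra.ι K x)) := by
  have h1 := mul_mem_freeGr PairGen.deg (ι_mem_freeGr (K := K) PairGen.deg x)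
    (ι_mem_freeGr (K := K) PairGen.deg y)
  have h2 := mul_mem_freeGr PairGen.deg (ι_mem_freeGr (K := K) PairGen.deg y)
    (ι_mem_freeGr (K := K) PairGen.deg x)
  rw [add_comm] at h2
  exact ⟨⟨x.deg + y.deg, h1, Submodule.smul_mem _ _ h2⟩, fun C f =>
    lift_comm_rel PairGen.deg C _ (homCoeff_mem β b C f) x y⟩

/-- The graded commutative algebra which corepresents the functor `C ↦ Hom(B, A ⊗ C)`. -/
noncomputable def corepresentingAlgebra : GCAlg K where
  R := RingQuot (HomRel β b)
  gr := quotGr PairGen.deg (HomRel β b)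
  graded := quotGraded PairGen.deg (HomRel β b) fun _ _ h => h.1
  comm := quotGr_comm PairGen.deg (HomRel β b) (homRel_comm β b)

/-- Factorization of each `f` is built into the relations. The point to prove is that the generic
matrix commutes with the operations: the required equations hold after specialization to any `f`,
and are therefore relations themselves. -/
theorem corepresentingAlgebra_property :
    ∃ η : B ⟶ (tensorFunctor A).obj (corepresentingAlgebra β b),
      ∀ (C : GCAlg K) (f : B ⟶ (tensorFunctor A).obj C),
        ∃! Φ : corepresentingAlgebra β b ⟶ C, f = η ≫ (tensorFunctor A).map Φ := by
  let U := corepresentingAlgebra β b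
  let x : ∀ ε, Fin (d ε) → ∀ p, I p → ε ≤ p → U.R := fun ε s p i h =>
    RingQuot.mkAlgHom K (HomRel β b) (FreeAlgebra.ι K (PairGen.mk ε s p i h))
  have hx : ∀ ε s p i h, x ε s p i h ∈ U.gr (p - ε) := fun ε s p i h =>
    mk_mem_quotGr PairGen.deg (HomRel β b) (ι_mem_freeGr PairGen.deg (PairGen.mk ε s p i h))
  have hlift : ∀ (C : GCAlg K) (f : B ⟶ (tensorFunctor A).obj C), ∃ Φ : U ⟶ C,
      ∀ y, Φ.toAlg (RingQuot.mkAlgHom K (HomRel β b) y) =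
        FreeAlgebra.lift K (homCoeff β b C f) y := fun C f => by
    obtain ⟨Φ, hΦ, hgr⟩ := exists_lift_of_rel PairGen.deg (HomRel β b) C (homCoeff β b C f)
      (homCoeff_mem β b C f) fun y z h => h.2 C f
    exact ⟨⟨Φ, hgr⟩, hΦ⟩
  have hgen : ∀ (C : GCAlg K) (f : B ⟶ (tensorFunctor A).obj C) (Φ : U ⟶ C),
      (∀ y, Φ.toAlg (RingQuot.mkAlgHom K (HomRel β b) y) =
        FreeAlgebra.lift K (homCoeff β b C f) y) → ∀ ε s p i h,
      Φ.toAlg (x ε s p i h) = coeff A.gr C b (f.toLin (β p i)) ⟨ε, s⟩ :=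
    fun C f Φ hΦ ε s p i h => (hΦ _).trans (FreeAlgebra.lift_ι_apply _ _)
  have hact : ∀ {n : ℕ} (m : ℤ) (μ : P.obj n), μ ∈ P.gr n m → ∀ (p : Fin n → ℕ) (i : ∀ j, I (p j)),
      coeffMap β b U x (B.act n μ fun j => β (p j) (i j)) =
        (tensorObj A U).act n μ fun j => coeffMap β b U x (β (p j) (i j)) := by
    intro n m μ hμ p i
    have ht := map_mem_grZ _ (coeffMap_gr A b β U x hx) (B.act_mem m μ p _ hμ fun j => (β _ (i j)).2)
    have ht' := (tensorObj A U).act_mem m μ p _ hμ fun j =>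
      coeffMap_gr A b β U x hx _ _ (β (p j) (i j)).2
    refine eq_of_coeff_eq A b U ht ht' fun θ hθ e he a => ?_
    rw [grZ_natCast _ hθ.symm] at ht ht'
    -- Both coefficients are homogeneous of degree `θ - e`, so they lift to homogeneous elements `y`
    -- and `z` of that degree in the free algebra. It remains to see that `y` and `z` agree at the
    -- coefficients of every morphism `f`.
    obtain ⟨y, hy, hy'⟩ := coeff_mem A.gr U b ht e he a
    obtain ⟨z, hz, hz'⟩ := coeff_mem A.gr U b ht' e he a
    refine hy'.symm.trans (Eq.trans (RingQuot.mkAlgHom_rel K ⟨⟨_, hy, hz⟩, fun C f => ?_⟩) hz')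
    obtain ⟨Φ, hΦ⟩ := hlift C f
    -- The generic map specializes to `f` along `Φ`.
    have hf : ∀ v, Φ.toAlg.toLinearMap.lTensor A.V (coeffMap β b U x v) = f.toLin v := fun v => by
      have : Φ.toAlg.toLinearMap.lTensor A.V ∘ₗ coeffMap β b U x = f.toLin :=
        (homBasis B.gr β).ext fun ⟨p, i⟩ => by
          rw [homBasis_apply, LinearMap.comp_apply, coeffMap_apply, lTensor_ofCoeff]
          simp only [AlgHom.toLinearMap_apply, hgen C f Φ hΦ]
          exact ofCoeff_coeff A.gr C b (f.map_gr p _ (β p i).2)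
      exact DFunLike.congr_fun this v
    rw [← hΦ y, ← hΦ z]
    refine ((congrArg Φ.toAlg hy').trans ?_).trans (congrArg Φ.toAlg hz').symm
    -- By naturality of coefficients and of the operations in `C`, the claim becomes the
    -- compatibility of `f` with `μ`.
    refine (coeff_lTensor A.gr b Φ.toAlg.toLinearMap _ _).symm.trans
      (Eq.trans ?_ (coeff_lTensor A.gr b Φ.toAlg.toLinearMap _ _))
    refine congrArg (fun t => coeff A.gr C b t ⟨e, a⟩) ((hf _).trans ((f.map_act μ _).trans ?_))
    refine Eq.trans ?_ (tensorMap_act A Φ μ _).symm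
    simp only [hf]
    rfl
  obtain ⟨η, -, hη⟩ := exists_universal β b U x hx
    (fun C Φ Ψ h => GCAlg.Hom.ext (ringQuot_algHom_ext fun x => h x.deg₁ x.s x.deg₂ x.i x.le))
    hact (fun C f => (hlift C f).imp (hgen C f))
  exact ⟨η, hη⟩

/-- If the components of `A` are finite-dimensional, then `A ⊗ -` has a left adjoint. -/
theorem tensorFunctor_isRightAdjoint (A : PAlgebra P) (h : ∀ p, FiniteDimensional K (A.gr p)) :
    (tensorFunctor A).IsRightAdjoint := by
  -- A left adjoint exists once every `B` has a universal arrow to the functor. Only the bases of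
  -- the components of `A` are finite; those of `B` are arbitrary.
  have : ∀ B, Limits.HasInitial (StructuredArrow B (tensorFunctor A)) := fun B => by
    obtain ⟨η, hη⟩ := corepresentingAlgebra_property
      (fun p => Module.Basis.ofVectorSpace K (B.gr p)) (fun p => Module.finBasis K (A.gr p))
    refine Limits.IsInitial.hasInitial (X := StructuredArrow.mk η)
      (Limits.IsInitial.ofUniqueHom
        (fun Y => StructuredArrow.homMk (hη Y.right Y.hom).choose
          (hη Y.right Y.hom).choose_spec.1.symm)
        fun Y g => StructuredArrow.ext _ _ ((hη Y.right Y.hom).choose_spec.2 g.right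
          (StructuredArrow.w g).symm))
  exact isRightAdjointOfStructuredArrowInitials _

end Corepresenting

/-! ### Commutative algebras in degree `0`, in particular `K` and `K^J` -/

section DegreeZero

variable (K : Type u) [Field K] (S : Type u) [CommRing S] [Algebra K S]

/-- The grading concentrated in degree `0`. -/
def gradingZero : ℕ → Submodule K S
  | 0 => ⊤
  | _ + 1 => ⊥

instance gradingZero_gradedMonoid : SetLike.GradedMonoid (gradingZero K S) where
  one_mem := Submodule.mem_top
  mul_mem := by
    rintro (_ | p) (_ | q) x y hx hy
    · exact Submodule.mem_top
    · have h : y = 0 := hy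
      rw [h, mul_zero]
      exact Submodule.zero_mem _
    · have h : x = 0 := hx
      rw [h, zero_mul]
      exact Submodule.zero_mem _
    · have h : x = 0 := hx
      rw [h, zero_mul]
      exact Submodule.zero_mem _

noncomputable instance gradingZero_decomposition :
    DirectSum.Decomposition (gradingZero K S) :=
  DirectSum.Decomposition.ofLinearMap (gradingZero K S)
    (DirectSum.lof K ℕ (fun p => gradingZero K S p) 0 ∘ₗ
      LinearMap.id.codRestrict (gradingZero K S 0) fun _ => Submodule.mem_top)
    (LinearMap.ext fun s => by
      simp only [LinearMap.comp_apply, DirectSum.coeLinearMap_lof]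
      rfl)
    (by
      ext p x : 2
      rcases p with _ | p
      · simp only [LinearMap.comp_apply, DirectSum.coeLinearMap_lof, LinearMap.id_apply]
        rfl
      · obtain rfl : x = 0 := Subtype.ext x.2
        simp only [map_zero])

noncomputable instance gradingZero_gradedAlgebra : GradedAlgebra (gradingZero K S) where

/-- A commutative algebra, as a graded commutative algebra concentrated in degree `0`. -/
noncomputable def GCAlg.ofCommRing : GCAlg K where
  R := S
  gr := gradingZero K S
  comm := by
    rintro (_ | p) q a b ha hb
    · simp [mul_comm]
    · have h : a = 0 := ha
      simp [h]

variable {K S}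

/-- The morphism of graded commutative algebras given by a homomorphism of commutative algebras. -/
noncomputable def GCAlg.ofCommRingMap {T : Type u} [CommRing T] [Algebra K T] (φ : S →ₐ[K] T) :
    GCAlg.ofCommRing K S ⟶ GCAlg.ofCommRing K T where
  toAlg := φ
  map_gr := by
    rintro (_ | q) x hx
    · exact (Submodule.mem_top : φ x ∈ (⊤ : Submodule K T))
    · have h : x = 0 := hx
      rw [h]
      exact map_zero φ

/-- The morphism to a power of `K` with given components. -/
noncomputable def GCAlg.toPi {J : Type u} (C : GCAlg K) (φ : J → (C ⟶ GCAlg.ofCommRing K K)) :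
    C ⟶ GCAlg.ofCommRing K (J → K) where
  toAlg := (AlgHom.pi fun j => (show C.R →ₐ[K] K from (φ j).toAlg) : C.R →ₐ[K] (J → K))
  map_gr := by
    rintro (_ | q) x hx
    · exact (Submodule.mem_top (R := K) (M := J → K))
    · exact funext fun j => (φ j).map_gr _ x hx

end DegreeZero

/-! ### Graded powers of a `P`-algebra -/

section Product

variable {K : Type u} [Field K] {P : GradedOperad.{u, w} K} (A : PAlgebra P) (J : Type u)

/-- The families of elements of `A` all of the same degree `p`. -/
def powerGr (p : ℕ) : Submodule K (J → A.V) := Submodule.pi Set.univ fun _ => A.gr p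

/-- The families of elements of `A` of bounded degree. -/
def powerSubmodule : Submodule K (J → A.V) := ⨆ p, powerGr A J p

variable {A J}

theorem mem_powerGr {p : ℕ} {g : J → A.V} : g ∈ powerGr A J p ↔ ∀ j, g j ∈ A.gr p := by
  simp [powerGr]

theorem powerGr_le (p : ℕ) : powerGr A J p ≤ powerSubmodule A J := le_iSup (powerGr A J) p

variable (A J)

/-- The homogeneous components of the power of `A`. -/
def powerGrading (p : ℕ) : Submodule K (powerSubmodule A J) :=
  (powerGr A J p).comap (powerSubmodule A J).subtype

/-- Independence is tested one coordinate at a time, where the component of degree `p` kills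
families of any other degree. The components span because only sums of families of constant degree
are admitted; the full product `J → A.V` need not be their sum. -/
theorem powerGrading_isInternal : DirectSum.IsInternal (powerGrading A J) := by
  refine DirectSum.isInternal_submodule_of_iSupIndep_of_iSup_eq_top ?_ ?_
  · refine iSupIndep_def.2 fun p => Submodule.disjoint_def.2 fun g hg hg' => ?_
    refine Subtype.ext (funext fun j => ?_)
    have hj : g.1 j ∈ A.gr p := mem_powerGr.1 hg j
    let L : powerSubmodule A J →ₗ[K] A.gr p := DirectSum.component K ℕ (fun p => A.gr p) p ∘ₗ
      (DirectSum.decomposeLinearEquiv A.gr).toLinearMap ∘ₗ LinearMap.proj j ∘ₗ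
        (powerSubmodule A J).subtype
    have hL : (⨆ q, ⨆ (_ : q ≠ p), powerGrading A J q) ≤ LinearMap.ker L :=
      iSup₂_le fun q hq x hx => decompose_eq_zero A.gr (mem_powerGr.1 hx j) hq
    have h0 : DirectSum.decompose A.gr (g.1 j) p = 0 := hL hg'
    have h1 := DirectSum.decompose_of_mem_same A.gr hj
    rw [h0] at h1
    exact h1.symm
  · refine Submodule.map_injective_of_injective (powerSubmodule A J).subtype_injective ?_
    rw [Submodule.map_iSup, Submodule.map_top, Submodule.range_subtype]
    refine iSup_congr fun p => ?_
    rw [powerGrading, Submodule.map_comap_subtype]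
    exact inf_eq_right.2 (powerGr_le p)

/-- A homogeneous operation applied to families of constant degrees gives values of one common
degree in all coordinates. Multilinearity then handles sums of such families. -/
theorem pi_act_mem {n : ℕ} (μ : P.obj n) (x : Fin n → J → A.V)
    (hx : ∀ k, x k ∈ powerSubmodule A J) :
    MultilinearMap.pi (fun j => (A.act n μ).compLinearMap fun _ => LinearMap.proj j) x ∈
      powerSubmodule A J := by
  have hμ : μ ∈ ⨆ m, P.gr n m := by
    rw [(P.isInternal n).submodule_iSup_eq_top]
    trivial
  induction hμ using Submodule.iSup_induction' with
  | mem m μ hμ =>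
    refine multilinear_mem_of_span _ _ (fun _ => ⋃ p, (powerGr A J p : Set (J → A.V)))
      (fun x hx => ?_) x fun k => by
        rw [← Submodule.iSup_eq_span]
        exact hx k
    simp only [Set.mem_iUnion, SetLike.mem_coe, mem_powerGr] at hx
    choose p hp using hx
    have h : ∀ j, A.act n μ (fun k => x k j) ∈ grZ A.gr ((∑ k, (p k : ℤ)) + m) := fun j =>
      A.act_mem m μ p _ hμ fun k => hp k j
    rcases hz : (∑ k, (p k : ℤ)) + m with z | z <;> rw [hz] at h
    · exact powerGr_le z (mem_powerGr.2 h)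
    · have h0 : MultilinearMap.pi
          (fun j => (A.act n μ).compLinearMap fun _ => LinearMap.proj j) x = 0 := funext h
      rw [h0]
      exact Submodule.zero_mem _
  | zero =>
    convert Submodule.zero_mem (powerSubmodule A J)
    ext
    simp
  | add μ ν _ _ hμ hν =>
    convert Submodule.add_mem _ hμ hν
    ext
    simp

/-- The power `A^J`, with componentwise operations. -/
noncomputable def powerObj : PAlgebra P where
  V := powerSubmodule A J
  gr := powerGrading A J
  decomposition := (powerGrading_isInternal A J).chooseDecomposition
  act n :=
    { toFun := fun μ => MultilinearMap.codRestrict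
        ((MultilinearMap.pi fun j => (A.act n μ).compLinearMap fun _ => LinearMap.proj
          (φ := fun _ : J => A.V) j).compLinearMap fun _ => (powerSubmodule A J).subtype)
        (powerSubmodule A J) fun x => pi_act_mem A J μ _ fun k => (x k).2
      map_add' := fun μ ν => MultilinearMap.ext fun x => Subtype.ext (funext fun j =>
        DFunLike.congr_fun (map_add (A.act n) μ ν) fun k => (x k).1 j)
      map_smul' := fun r μ => MultilinearMap.ext fun x => Subtype.ext (funext fun j =>
        DFunLike.congr_fun (map_smul (A.act n) r μ) fun k => (x k).1 j) }
  act_mem {n} m μ p x hμ hx := by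
    have h : ∀ j, A.act n μ (fun k => (x k).1 j) ∈ grZ A.gr ((∑ k, (p k : ℤ)) + m) := fun j =>
      A.act_mem m μ p _ hμ fun k => mem_powerGr.1 (hx k) j
    rcases hz : (∑ k, (p k : ℤ)) + m with z | z <;> rw [hz] at h
    · exact mem_powerGr.2 h
    · exact Subtype.ext (funext h)
  act_one x := Subtype.ext (funext fun j => A.act_one fun k => (x k).1 j)
  act_comp {m n l} i h d μ ν p x hν hx := Subtype.ext (funext fun j => by
    refine (A.act_comp i h d μ ν p (fun k => (x k).1 j) hν
      fun k => mem_powerGr.1 (hx k) j).trans ?_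
    refine congrArg (fun y => _ • A.act m μ y) (funext fun k => ?_)
    by_cases hk : k = i
    · simp only [insertBlock, hk, dite_true]
      rfl
    · simp only [insertBlock, hk, dite_false]
      rfl)
  act_perm σ μ p x hx := Subtype.ext (funext fun j =>
    A.act_perm σ μ p (fun k => (x k).1 j) fun k => mem_powerGr.1 (hx k) j)

/-- The projections of the power `A^J`. -/
noncomputable def powerProj (j : J) : powerObj A J ⟶ A where
  toLin := LinearMap.proj j ∘ₗ (powerSubmodule A J).subtype
  map_gr _ _ hx := mem_powerGr.1 hx j
  map_act _ _ := rfl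

/-- The morphism `A ⟶ A ⊗ C` which sends `a` to `a ⊗ 1`. -/
noncomputable def tensorUnit (C : GCAlg K) : A ⟶ (tensorFunctor A).obj C where
  toLin := (TensorProduct.mk K A.V C.R).flip 1
  map_gr _ _ hx := tmul_mem_tensorGr A.gr C (add_zero _) hx (SetLike.GradedOne.one_mem (A := C.gr))
  map_act := map_act_of_basis (B := tensorObj A C)
    (fun p => Module.Basis.ofVectorSpace K (A.gr p)) _ fun {n} m μ hμ p i => by
      -- The factors `1` have degree `0`, so the Koszul sign is trivial and their product is `1`.
      refine Eq.trans ?_ (tensorObj_act_tmul A C μ p (fun _ => 0) _ (fun _ => 1)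
        (fun j => (Module.Basis.ofVectorSpace K (A.gr (p j)) (i j)).2)
        fun _ => SetLike.GradedOne.one_mem (A := C.gr)).symm
      simp [crossSign]
      rfl

end Product

/-! ### Necessity of finite dimension -/

section FiniteDimensional

variable {K : Type u} [Field K]

/-- An element of `V ⊗ K^J` has components in a finite-dimensional subspace of `V`. -/
theorem exists_finiteDimensional_of_tensor_pi {V : Type*} [AddCommGroup V] [Module K V] {J : Type*}
    (t : V ⊗[K] (J → K)) : ∃ W : Submodule K V, FiniteDimensional K W ∧
      ∀ j, TensorProduct.rid K V ((LinearMap.proj (R := K) (φ := fun _ : J => K) j).lTensor V t) ∈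
        W := by
  induction t using TensorProduct.induction_on with
  | zero => exact ⟨⊥, inferInstance, fun j => by simp⟩
  | tmul v c =>
    refine ⟨K ∙ v, inferInstance, fun j => ?_⟩
    rw [LinearMap.lTensor_tmul, TensorProduct.rid_tmul]
    exact Submodule.smul_mem _ _ (Submodule.mem_span_singleton_self v)
  | add s t hs ht =>
    obtain ⟨W, _, hW⟩ := hs
    obtain ⟨W', _, hW'⟩ := ht
    refine ⟨W ⊔ W', inferInstance, fun j => ?_⟩
    rw [map_add, map_add]
    exact Submodule.add_mem_sup (hW j) (hW' j)

variable {P : GradedOperad.{u, w} K} (A : PAlgebra P)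

/-- If `A ⊗ -` has a left adjoint, then the components of `A` are finite-dimensional. -/
theorem finiteDimensional_of_isRightAdjoint (h : (tensorFunctor A).IsRightAdjoint) (p : ℕ) :
    FiniteDimensional K (A.gr p) := by
  obtain ⟨L, ⟨adj⟩⟩ := h.exists_leftAdjoint
  -- The index set is the whole of `A_p`, so that a single family can list all of its elements.
  let J := A.gr p
  let B := powerObj A J
  let k : GCAlg K := GCAlg.ofCommRing K K
  let kJ : GCAlg K := GCAlg.ofCommRing K (J → K)
  let π : J → (kJ ⟶ k) := fun j => GCAlg.ofCommRingMap (Pi.evalAlgHom K (fun _ : J => K) j)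
  let f : ∀ _ : J, B ⟶ (tensorFunctor A).obj k := fun j => powerProj A J j ≫ tensorUnit A k
  let φ : ∀ _ : J, L.obj B ⟶ k := fun j => (adj.homEquiv B k).symm (f j)
  -- On the side of graded commutative algebras the components can be assembled, because maps to `K`
  -- in degree `0` combine into one map to `K^J`. The adjunction carries the result back to `F`.
  let Φ : L.obj B ⟶ kJ := GCAlg.toPi (L.obj B) φ
  have hΦ : ∀ j, Φ ≫ π j = φ j := fun j => rfl
  let F : B ⟶ (tensorFunctor A).obj kJ := adj.homEquiv B kJ Φ
  have hF : ∀ j, F ≫ (tensorFunctor A).map (π j) = f j := fun j => by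
    rw [← adj.homEquiv_naturality_right, hΦ]
    exact (adj.homEquiv B k).apply_symm_apply (f j)
  -- The tautological family, whose coordinate at `j` is `j` itself. It is homogeneous of degree
  -- `p`, hence lies in the graded power.
  let g : B.V := ⟨fun j : J => (j : A.V), powerGr_le p (mem_powerGr.2 fun j => j.2)⟩
  obtain ⟨W, hW, hmem⟩ := exists_finiteDimensional_of_tensor_pi (K := K) (J := J) (F.toLin g)
  -- The component of `F g` at the index `a` is the image `a ⊗ 1` of the coordinate `a` of `g`, so
  -- `a ∈ W`.
  have hle : A.gr p ≤ W := fun a ha => by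
    have h1 : (F ≫ (tensorFunctor A).map (π ⟨a, ha⟩)).toLin g = (f ⟨a, ha⟩).toLin g := by rw [hF]
    have h2 : TensorProduct.rid K A.V ((F ≫ (tensorFunctor A).map (π ⟨a, ha⟩)).toLin g) ∈ W :=
      hmem ⟨a, ha⟩
    rw [h1] at h2
    have h3 : TensorProduct.rid K A.V ((f ⟨a, ha⟩).toLin g) = a := by
      change TensorProduct.rid K A.V (a ⊗ₜ[K] (1 : K)) = a
      simp
    exact h3 ▸ h2
  exact Submodule.finiteDimensional_of_le hle

end FiniteDimensional

end GradedOperads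

theorem theorem3p6 {K : Type u} [Field K] (P : GradedOperad.{u, w} K) (A : PAlgebra P) :
    ((tensorFunctor A).IsRightAdjoint ↔ ∀ p : ℕ, FiniteDimensional K (A.gr p)) ∧
    ∀ (d : ℕ → ℕ) (b : ∀ p, Module.Basis (Fin (d p)) K (A.gr p)),
      ∃ η : A ⟶ (tensorFunctor A).obj (universalAlgebra A b),
        (∀ (p : ℕ) (i : Fin (d p)),
          η.toLin (b p i) = ∑ ε : Fin (p + 1), ∑ s : Fin (d ε),
            (b ε s : A.V) ⊗ₜ[K] universalGen A b (Gen.mk ε s p i (Nat.lt_succ_iff.1 ε.2))) ∧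
        ∀ (C : GCAlg K) (f : A ⟶ (tensorFunctor A).obj C),
          ∃! Φ : universalAlgebra A b ⟶ C, f = η ≫ (tensorFunctor A).map Φ :=
  ⟨⟨finiteDimensional_of_isRightAdjoint A, tensorFunctor_isRightAdjoint A⟩,
    fun _ b => universalAlgebra_property A b⟩
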